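/- \textbf{Setting.} Fix constants $m,M>0$. A Hamiltonian $H(t,q,p):\mathbb R\times\mathbb R^d\times(\mathbb R^d)^*\to\mathbb R$ is called \emph{admissible} (with constants $m,M$) if it is $C^2$ and, for all $(t,q,p)$, $\|d^2H(t,q,p)\|\le M$ (Euclidean operator norm), $\partial^2_{pp}H(t,q,p)\ge m\,\mathrm{Id}$ in the sense of quadratic forms, and $\frac m2|p|^2-M\le H(t,q,p)\le\frac M2|p|^2+M$. Let $\sigma=m^2/(64M^3)$. For $0<b-a<\sigma$ let $S_a^b(q_0,q_1)=\int_a^b p\cdot\dot q-H(s,q,p)\,ds$ be the action of the unique solution $(q(s),p(s))$, $s\in[a,b]$, of $\dot q=\partial_pH$, $\dot p=-\partial_qH$ with $q(a)=q_0$, $q(b)=q_1$. For arbitrary $a<b$ let $$A_a^b(q_0,q_1)=\min_{\theta_0=q_0,\ \theta_n=q_1}\ \sum_{i=0}^{n-1}S_{a+ih}^{a+(i+1)h}(\theta_i,\theta_{i+1}),\qquad h=\frac{b-a}n,$$ where $n$ is the smallest positive integer with $(b-a)/n<\sigma$ (any such $n$ gives the same value). For $a<b$ and $u:\mathbb R^d\to[-\infty,+\infty]$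 define the Lax--Oleinik operators $$\mathbf T_a^bu(q)=\inf_{\theta}\big(u(\theta)+A_a^b(\theta,q)\big),\qquad \check{\mathbf T}_b^au(q)=\sup_\theta\big(u(\theta)-A_a^b(q,\theta)\big),$$ and, for $t_0\in\mathbb R$ and $\delta,t>0$, $$\mathbf R^t=\check{\mathbf T}_{t_0+\delta t}^{t_0}\circ\mathbf T_{t_0-t}^{t_0+\delta t}\circ\check{\mathbf T}_{t_0}^{t_0-t},\qquad \check{\mathbf R}^t=\mathbf T^{t_0}_{t_0-\delta t}\circ\check{\mathbf T}^{t_0-\delta t}_{t_0+t}\circ\mathbf T^{t_0+t}_{t_0}.$$ A function $u:\mathbb R^d\to\mathbb R$ is semi-concave (resp. semi-convex) if $u-K|\cdot|^2$ is concave (resp. $u+K|\cdot|^2$ is convex) for some $K$; it is $C^{1,1}$ if it is differentiable with Lipschitz differential. \textbf{Theorem.} There exists $\delta\in\,]0,1[$, depending only on $m$ and $M$, such that for every $d$ and every admissible Hamiltonian $H$ on $\mathbb R\times\mathbb R^d\times(\mathbb R^d)^*$: \begin{itemize} \item For each $t_0\in\mathbb R$ and $t\in\,]0,1[$, the finite-valued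 functions in the images of $\mathbf R^t$ and $\check{\mathbf R}^t$ are uniformly $C^{1,1}$: there is a constant $K$ such that each of them is differentiable with $K$-Lipschitz differential. \item For each semi-concave function $u:\mathbb R^d\to\mathbb R$ there exists $T>0$ such that $\mathbf R^tu\le u$ and $\check{\mathbf R}^tu\le u$ for each $t_0\in\mathbb R$ and $t\in\,]0,T[$. \item For each semi-convex function $u:\mathbb R^d\to\mathbb R$ there exists $T>0$ such that $\mathbf R^tu\ge u$ and $\check{\mathbf R}^tu\ge u$ for each $t_0\in\mathbb R$ and $t\in\,]0,T[$. \item For each $C^{1,1}$ function $u:\mathbb R^d\to\mathbb R$ there exists $T>0$ such that $\mathbf R^tu=u$ and $\check{\mathbf R}^tu=u$ for each $t_0\in\mathbb R$ and $t\in\,]0,T[$. \end{itemize} -/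

import Mathlib

open Set

noncomputable section

namespace WeakKAM

/-- The configuration space `ℝ^d` with its Euclidean norm. Momenta, that is, elements of the dual
space, are identified with vectors through the inner product. -/
abbrev E (d : ℕ) : Type := EuclideanSpace ℝ (Fin d)

/-- The Euclidean norm on `ℝ × ℝ^d × ℝ^d` (the norm of the product type is the sup norm). -/
def enorm2 {d : ℕ} (z : ℝ × E d × E d) : ℝ :=
  Real.sqrt (z.1 ^ 2 + ‖z.2.1‖ ^ 2 + ‖z.2.2‖ ^ 2)

/-- The Hamiltonian `H(t,q,p)` as a function of one variable in `ℝ × ℝ^d × ℝ^d`. -/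
def total {d : ℕ} (H : ℝ → E d → E d → ℝ) : ℝ × E d × E d → ℝ :=
  fun x => H x.1 x.2.1 x.2.2

/-- The standing hypotheses on a Hamiltonian with constants `m` and `M`: it is `C²`, its second
differential is bounded by `M`, it is uniformly convex in `p`, and it has quadratic growth. -/
structure IsAdmissible (m M : ℝ) {d : ℕ} (H : ℝ → E d → E d → ℝ) : Prop where
  contDiff : ContDiff ℝ 2 (total H)
  /-- `‖d²H(t,q,p)‖ ≤ M`, in the operator norm for the Euclidean norm. -/
  hessian_le : ∀ x z w : ℝ × E d × E d,
    |fderiv ℝ (fderiv ℝ (total H)) x z w| ≤ M * enorm2 z * enorm2 w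
  /-- `∂²_{pp} H ≥ m Id` in the sense of quadratic forms. -/
  convex : ∀ (t : ℝ) (q p v : E d), m * ‖v‖ ^ 2 ≤ fderiv ℝ (fderiv ℝ (H t q)) p v v
  lower : ∀ (t : ℝ) (q p : E d), m / 2 * ‖p‖ ^ 2 - M ≤ H t q p
  upper : ∀ (t : ℝ) (q p : E d), H t q p ≤ M / 2 * ‖p‖ ^ 2 + M

/-- The curve `s ↦ (q s, p s)`, on the interval `[a,b]`, solves the Hamiltonian system
`q' = ∂_p H(s,q,p)`, `p' = - ∂_q H(s,q,p)`. -/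
def IsOrbit {d : ℕ} (H : ℝ → E d → E d → ℝ) (a b : ℝ) (q p : ℝ → E d) : Prop :=
  ∀ s ∈ Icc a b,
    HasDerivWithinAt q (gradient (fun y => H s (q s) y) (p s)) (Icc a b) s ∧
    HasDerivWithinAt p (-gradient (fun x => H s x (p s)) (q s)) (Icc a b) s

/-- The Hamiltonian action `∫_a^b p · q' - H(s,q,p) ds` of a curve on `[a,b]`. -/
def action {d : ℕ} (H : ℝ → E d → E d → ℝ) (a b : ℝ) (q p : ℝ → E d) : ℝ :=
  ∫ s in a..b, (inner ℝ (p s) (derivWithin q (Icc a b) s) - H s (q s) (p s))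

open Classical in
/-- The generating function `S_a^b(q₀,q₁)`: the action of the orbit on `[a,b]` whose projection
starts at `q₀` and ends at `q₁`. For admissible Hamiltonians and `0 < b - a < sigma m M` this
orbit exists and is unique; the value is not used otherwise. -/
def genFun {d : ℕ} (H : ℝ → E d → E d → ℝ) (a b : ℝ) (q₀ q₁ : E d) : ℝ :=
  if h : ∃ x : (ℝ → E d) × (ℝ → E d), IsOrbit H a b x.1 x.2 ∧ x.1 a = q₀ ∧ x.1 b = q₁ then
    action H a b h.choose.1 h.choose.2
  else 0

/-- A time `σ`, depending only on `m` and `M`, below which the flow of every admissible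
Hamiltonian has the twist property and its generating function is convex in each variable. -/
def sigma (m M : ℝ) : ℝ := m ^ 2 / (64 * M ^ 3)

/-- The smallest positive number of pieces of equal length less than `sigma m M` into which
`[a,b]` can be cut. -/
def pieces (m M a b : ℝ) : ℕ := ⌊(b - a) / sigma m M⌋₊ + 1

/-- The minimal action
`A_a^b(q₀,q₁) = min_θ ∑_{i<n} S_{a+ih}^{a+(i+1)h}(θ_i, θ_{i+1})`, where `h = (b-a)/n`,
over all `θ` with `θ_0 = q₀` and `θ_n = q₁`.
The value does not depend on the choice of `n` with `(b-a)/n < sigma m M`. -/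
def minAction (m M : ℝ) {d : ℕ} (H : ℝ → E d → E d → ℝ) (a b : ℝ) (q₀ q₁ : E d) : ℝ :=
  sInf {s : ℝ | ∃ θ : ℕ → E d, θ 0 = q₀ ∧ θ (pieces m M a b) = q₁ ∧
    s = ∑ i ∈ Finset.range (pieces m M a b),
      genFun H (a + i * ((b - a) / pieces m M a b))
        (a + (i + 1) * ((b - a) / pieces m M a b)) (θ i) (θ (i + 1))}

/-- The forward Lax-Oleinik operator from time `a` to time `b`, for `a < b`, on extended
real-valued functions. -/
def laxOleinik (m M : ℝ) {d : ℕ} (H : ℝ → E d → E d → ℝ) (a b : ℝ) (u : E d → EReal) :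
    E d → EReal :=
  fun q => ⨅ θ : E d, (u θ + (minAction m M H a b θ q : EReal))

/-- The dual Lax-Oleinik operator, from time `b` back to time `a`, for `a < b`. -/
def laxOleinikDual (m M : ℝ) {d : ℕ} (H : ℝ → E d → E d → ℝ) (b a : ℝ) (u : E d → EReal) :
    E d → EReal :=
  fun q => ⨆ θ : E d, (u θ - (minAction m M H a b q θ : EReal))

/-- The operator `R^t`, based at time `t₀`, with parameter `δ`. -/
def regOp (m M : ℝ) {d : ℕ} (H : ℝ → E d → E d → ℝ) (δ t₀ t : ℝ) (u : E d → EReal) :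
    E d → EReal :=
  laxOleinikDual m M H (t₀ + δ * t) t₀
    (laxOleinik m M H (t₀ - t) (t₀ + δ * t)
      (laxOleinikDual m M H t₀ (t₀ - t) u))

/-- The operator `Ř^t`, based at time `t₀`, with parameter `δ`. -/
def regOpDual (m M : ℝ) {d : ℕ} (H : ℝ → E d → E d → ℝ) (δ t₀ t : ℝ) (u : E d → EReal) :
    E d → EReal :=
  laxOleinik m M H (t₀ - δ * t) t₀
    (laxOleinikDual m M H (t₀ + t) (t₀ - δ * t)
      (laxOleinik m M H t₀ (t₀ + t) u))

/-- A real-valued function, seen as an extended real-valued one. -/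
def toExt {d : ℕ} (u : E d → ℝ) : E d → EReal := fun q => (u q : EReal)

/-- `u` is semi-concave: `u - K |·|²` is concave for some `K`. -/
def SemiConcave {d : ℕ} (u : E d → ℝ) : Prop :=
  ∃ K : ℝ, ConcaveOn ℝ univ (fun q => u q - K * ‖q‖ ^ 2)

/-- `u` is semi-convex: `u + K |·|²` is convex for some `K`. -/
def SemiConvex {d : ℕ} (u : E d → ℝ) : Prop :=
  ∃ K : ℝ, ConvexOn ℝ univ (fun q => u q + K * ‖q‖ ^ 2)

/-- `u` is `C^{1,1}` and its differential is `K`-Lipschitz. -/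
def C11With {d : ℕ} (K : NNReal) (u : E d → ℝ) : Prop :=
  Differentiable ℝ u ∧ LipschitzWith K (fderiv ℝ u)

/-- `u` is `C^{1,1}`: differentiable with a Lipschitz differential. -/
def C11 {d : ℕ} (u : E d → ℝ) : Prop := ∃ K : NNReal, C11With K u

end WeakKAM

end

/-! Write `T` and `Ť` for the two Lax–Oleinik operators over one time interval. They form a Galois
connection, so `Ť T ≤ id ≤ T Ť`. By the semigroup property the middle operator of `R^t` can be cut
at `t₀`, giving `R^t u = (Ť T)(T Ť) u`, with the outer pair over time `δt` and the inner pair over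
time `t`. On semi-concave functions `T Ť` is the identity in short time, so only the decreasing
factor remains and `R^t u ≤ u`. On semi-convex functions `Ť T` is the identity, so `R^t u ≥ u`. A
`C^{1,1}` function is both.

For the regularity, `T` over a time of order `t` gives a semi-concave function with constant of
order `1/t`. Then `Ť` over the shorter time `δt` gives a semi-convex one and keeps semi-concavity,
because the convexity `c/(δt)` of the action dominates when `δ` is small
(`C11With_of_supConv_infConv`). A function semi-convex and semi-concave is `C^{1,1}`. The dual
operator follows by reversing time and changing signs.

All that is used of the action is `IsTwistKernel`: a triangle inequality, near-optimal splitting,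
and short-time first-order expansions with error between `(c/h)|Δy - Δx|² - C(|Δx|² + |Δy|²)` and
`(C/h)(|Δx|² + |Δy|²)`. The constants depend only on `m` and `M`, hence so does `δ`. Minima need not
be attained: errors `ε` are carried throughout.

The expansion comes from comparing two orbits. The difference of their actions, minus boundary
terms, is the integral of a Taylor remainder of `H` (`IsOrbit.action_sub_bounds`), at least
`m/2|Δp|² - M/2|Δq|²`. Below time `σ` the differences `Δp`, `Δq` stay near their initial values, and
`Δp` is comparable with `(Δq(b) - Δq(a))/(b - a)` up to multiples of `|Δq(a)|`. -/

namespace WeakKAM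

/-! ### Subgradients, semi-convexity and `C^{1,1}` functions. -/

section ConvexAnalysis

variable {V : Type*} [NormedAddCommGroup V] [InnerProductSpace ℝ V]

/-- A finite convex function on a finite-dimensional space has a subgradient at every point. -/
theorem exists_subgradient [FiniteDimensional ℝ V] {f : V → ℝ}
    (hf : ConvexOn ℝ univ f) (x : V) :
    ∃ p : V, ∀ y, f x + inner ℝ p (y - x) ≤ f y := by
  have hcont : Continuous f := hf.locallyLipschitz.continuous
  have hopen : IsOpen {z : V × ℝ | z.1 ∈ univ ∧ f z.1 < z.2} := by
    simp only [mem_univ, true_and]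
    exact isOpen_lt (hcont.comp continuous_fst) continuous_snd
  -- Separate `(x, f x)` from the strict epigraph, open because `f` is continuous. The vertical
  -- coefficient `k` is negative, and dividing the horizontal part by `-k` gives the slope.
  obtain ⟨g, hg⟩ := geometric_hahn_banach_open_point (x := (x, f x))
    hf.convex_strict_epigraph hopen (by simp)
  have hsplit : ∀ (y : V) (r : ℝ), g (y, r) = g (y, 0) + r * g (0, 1) := by
    intro y r
    have : ((y, r) : V × ℝ) = (y, 0) + r • (0, 1) := by ext <;> simp
    rw [this, map_add, map_smul, smul_eq_mul]
  set k := g (0, 1) with hk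
  have hneg : k < 0 := by
    have := hg (x, f x + 1) (by simp)
    rw [hsplit x (f x + 1), hsplit x (f x)] at this
    linarith
  have hle : ∀ y, g (y, 0) + f y * k ≤ g (x, 0) + f x * k := by
    intro y
    refine le_of_forall_pos_lt_add fun ε hε => ?_
    have := hg (y, f y + ε / (-k)) (by simpa using div_pos hε (by linarith))
    rw [hsplit y, hsplit x] at this
    have h2 : ε / (-k) * k = -ε := by
      have := hneg.ne
      field_simp
    nlinarith
  set l : V →L[ℝ] ℝ := (-k)⁻¹ • g.comp (ContinuousLinearMap.inl ℝ V ℝ) with hl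
  refine ⟨(InnerProductSpace.toDual ℝ V).symm l, fun y => ?_⟩
  rw [InnerProductSpace.toDual_symm_apply]
  have h1 : l (y - x) = (-k)⁻¹ * (g (y, 0) - g (x, 0)) := by
    simp [hl, ContinuousLinearMap.comp_apply]
    left
    rw [← map_sub]; simp
  rw [h1]
  have h3 : (-k)⁻¹ * (g (y, 0) - g (x, 0)) ≤ (-k)⁻¹ * (f y * (-k) - f x * (-k)) := by
    apply mul_le_mul_of_nonneg_left _ (by rw [inv_nonneg]; linarith)
    linarith [hle y]
  have h4 : (-k)⁻¹ * (f y * (-k) - f x * (-k)) = f y - f x := by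
    have : k ≠ 0 := hneg.ne
    field_simp; ring
  linarith

theorem norm_sq_expand (x y : V) :
    ‖y‖ ^ 2 = ‖x‖ ^ 2 + inner ℝ ((2 : ℝ) • x) (y - x) + ‖y - x‖ ^ 2 := by
  rw [inner_smul_left, inner_sub_right, norm_sub_sq_real, real_inner_self_eq_norm_sq,
    real_inner_comm]
  simp; ring

/-- A semi-convex function has at every point a quadratic lower bound that is tangent there. -/
theorem exists_semiconvex_subgradient [FiniteDimensional ℝ V] {f : V → ℝ} {K : ℝ}
    (hf : ConvexOn ℝ univ (fun q => f q + K * ‖q‖ ^ 2)) (x : V) :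
    ∃ p : V, ∀ y, f x + inner ℝ p (y - x) - K * ‖y - x‖ ^ 2 ≤ f y := by
  obtain ⟨p, hp⟩ := exists_subgradient hf x
  refine ⟨p - K • ((2 : ℝ) • x), fun y => ?_⟩
  have h1 := hp y
  have h2 := norm_sq_expand x y
  rw [inner_sub_left, inner_smul_left]
  simp only [conj_trivial]
  rw [h2] at h1
  linarith

theorem exists_semiconcave_supergradient [FiniteDimensional ℝ V] {f : V → ℝ} {K : ℝ}
    (hf : ConcaveOn ℝ univ (fun q => f q - K * ‖q‖ ^ 2)) (x : V) :
    ∃ p : V, ∀ y, f y ≤ f x + inner ℝ p (y - x) + K * ‖y - x‖ ^ 2 := by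
  have h : ConvexOn ℝ univ (fun q => (-f q) + K * ‖q‖ ^ 2) := by
    have := hf.neg
    refine this.congr fun q _ => ?_
    simp; ring
  obtain ⟨p, hp⟩ := exists_semiconvex_subgradient h x
  refine ⟨-p, fun y => ?_⟩
  have := hp y
  rw [inner_neg_left]
  linarith

/-- A function with uniform quadratic two-sided first-order expansions is `C^{1,1}`. -/
theorem differentiable_lipschitz_of_expansion {f : V → ℝ} {K : NNReal} (p : V → V)
    (hp : ∀ x y, |f y - f x - inner ℝ (p x) (y - x)| ≤ K * ‖y - x‖ ^ 2) :
    Differentiable ℝ f ∧ LipschitzWith (6 * K) (fderiv ℝ f) := by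
  have hder : ∀ x, HasFDerivAt f (innerSL ℝ (p x)) x := by
    intro x
    rw [hasFDerivAt_iff_isLittleO_nhds_zero]
    have hO : (fun h : V => f (x + h) - f x - innerSL ℝ (p x) h) =O[nhds 0]
        fun h : V => ‖h‖ ^ 2 := by
      refine Asymptotics.IsBigO.of_bound K (Filter.Eventually.of_forall fun h => ?_)
      have := hp x (x + h)
      simpa using this
    refine hO.trans_isLittleO ?_
    have := Asymptotics.isLittleO_pow_id (𝕜 := ℝ) (n := 2) (by norm_num)
    exact (this.comp_tendsto (tendsto_norm_zero (E := V))).trans_isBigO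
      (Asymptotics.isBigO_refl _ _).norm_left
  refine ⟨fun x => (hder x).differentiableAt, ?_⟩
  refine LipschitzWith.of_dist_le_mul fun x y => ?_
  rw [(hder x).fderiv, (hder y).fderiv, dist_eq_norm, ← map_sub, innerSL_apply_norm, dist_comm,
    dist_eq_norm]
  set g := p x - p y with hg
  rcases eq_or_ne g 0 with h0 | h0
  · rw [h0, norm_zero]; positivity
  set r := ‖y - x‖ with hr
  -- A step of length `r` along the gradient difference, so `⟨g, w⟩ = r‖g‖`. Comparing the
  -- expansions of `f (y + w)` from `x` and from `y` costs `K(4 + 1 + 1)r²`, hence the factor 6.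
  set w := (r / ‖g‖) • g with hw
  have hgn : 0 < ‖g‖ := norm_pos_iff.2 h0
  have hwn : ‖w‖ = r := by
    rw [hw, norm_smul, Real.norm_of_nonneg (by positivity)]; field_simp
  have h1 := (abs_le.1 (hp x (y + w))).1
  have h2 := (abs_le.1 (hp y (y + w))).2
  have h3 := (abs_le.1 (hp x y)).2
  have e1 : inner ℝ (p x) (y + w - x) = inner ℝ (p x) (y - x) + inner ℝ (p x) w := by
    rw [← inner_add_right]; congr 1; abel
  have e2 : inner ℝ (p x) w - inner ℝ (p y) w = r * ‖g‖ := by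
    rw [← inner_sub_left, ← hg, hw, inner_smul_right, real_inner_self_eq_norm_sq]
    field_simp
  have e3 : ‖y + w - x‖ ≤ 2 * r := by
    calc ‖y + w - x‖ = ‖(y - x) + w‖ := by congr 1; abel
      _ ≤ ‖y - x‖ + ‖w‖ := norm_add_le _ _
      _ = 2 * r := by rw [hwn]; ring
  have e4 : ‖y + w - x‖ ^ 2 ≤ (2 * r) ^ 2 := by gcongr
  rw [add_sub_cancel_left, hwn] at h2
  rw [e1] at h1
  have hK : (0 : ℝ) ≤ K := K.2
  have key : r * ‖g‖ ≤ 6 * K * r ^ 2 := by nlinarith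
  have hr0 : 0 ≤ r := norm_nonneg _
  push_cast
  rcases hr0.eq_or_lt with h | h
  · exfalso
    have hxy : y - x = 0 := by rw [← norm_eq_zero]; rw [← hr, ← h]
    apply h0
    rw [hg, sub_eq_zero.1 hxy, sub_self]
  · nlinarith

/-- A function that is both semi-convex and semi-concave is `C^{1,1}`. -/
theorem differentiable_lipschitz_of_semiconvex_semiconcave [FiniteDimensional ℝ V]
    {f : V → ℝ} {K : NNReal}
    (hf : ConvexOn ℝ univ (fun q => f q + K * ‖q‖ ^ 2))
    (hf' : ConcaveOn ℝ univ (fun q => f q - K * ‖q‖ ^ 2)) :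
    Differentiable ℝ f ∧ LipschitzWith (6 * K) (fderiv ℝ f) := by
  choose p hp using exists_semiconvex_subgradient hf
  refine differentiable_lipschitz_of_expansion p fun x y => ?_
  obtain ⟨p', hp'⟩ := exists_semiconcave_supergradient hf' x
  have heq : p' = p x := by
    by_contra hne
    set g := p x - p' with hg
    have hg0 : 0 < ‖g‖ := norm_pos_iff.2 (sub_ne_zero.2 (Ne.symm hne))
    -- Along `g` the lower bound gains on the upper one linearly in `s`, while the room between them
    -- is quadratic. The value `s = 1/(2K + 1)` is a contradiction.
    have key : ∀ s : ℝ, s * ‖g‖ ^ 2 ≤ 2 * K * s ^ 2 * ‖g‖ ^ 2 := by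
      intro s
      have h1 := hp x (x + s • g)
      have h2 := hp' (x + s • g)
      have h3 : inner ℝ (p x) (s • g) - inner ℝ p' (s • g) = s * ‖g‖ ^ 2 := by
        rw [← inner_sub_left, ← hg, inner_smul_right, real_inner_self_eq_norm_sq]
      simp only [add_sub_cancel_left, norm_smul, mul_pow, Real.norm_eq_abs, sq_abs] at h1 h2
      nlinarith
    have hK : (0 : ℝ) ≤ K := K.2
    obtain ⟨s, hs0, hs⟩ : ∃ s : ℝ, 0 < s ∧ s * (2 * K + 1) = 1 :=
      ⟨1 / (2 * K + 1), by positivity, by field_simp⟩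
    have h3 := le_of_mul_le_mul_right (key s) (by positivity)
    have h4 : 2 * (K : ℝ) * s ^ 2 = s - s * s := by linear_combination s * hs
    have h5 : 0 < s * s := by positivity
    linarith
  have h1 := hp x y
  have h2 := hp' y
  rw [heq] at h2
  rw [abs_le]
  constructor <;> linarith

end ConvexAnalysis

/-! ### Inf- and sup-convolutions with a kernel, and their regularizing effect. -/

section Kernel

variable {d : ℕ}

/-- The inf-convolution of an extended real-valued function with a kernel. -/
noncomputable def infConv (k : E d → E d → ℝ) (u : E d → EReal) : E d → EReal :=
  fun q => ⨅ θ : E d, (u θ + (k θ q : EReal))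

/-- The sup-convolution of an extended real-valued function with the opposite of a kernel. -/
noncomputable def supConv (k : E d → E d → ℝ) (u : E d → EReal) : E d → EReal :=
  fun q => ⨆ θ : E d, (u θ - (k q θ : EReal))

/-- Both sides say `u θ ≤ v q + k q θ` for all `q`, `θ`; the finiteness of the kernel allows it to
change sides. -/
theorem gc_supConv_infConv (k : E d → E d → ℝ) : GaloisConnection (supConv k) (infConv k) := by
  intro u v
  simp only [Pi.le_def, supConv, infConv, iSup_le_iff, le_iInf_iff]
  rw [forall_comm]
  refine forall_congr' fun θ => forall_congr' fun q => ?_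
  exact EReal.sub_le_iff_le_add (.inl (EReal.coe_ne_bot _)) (.inl (EReal.coe_ne_top _))

theorem supConv_eq_neg_infConv (k : E d → E d → ℝ) (u : E d → EReal) :
    supConv k u = -infConv (fun x y => k y x) (-u) := by
  funext q
  have h : -(⨅ θ, (-u θ + (k q θ : EReal))) = ⨆ θ, -(-u θ + (k q θ : EReal)) :=
    congrArg OrderDual.ofDual (EReal.negOrderIso.map_iInf fun θ => (-u θ + (k q θ : EReal)))
  change _ = -(⨅ θ, (-u θ + (k q θ : EReal)))
  rw [h]
  refine iSup_congr fun θ => ?_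
  rw [EReal.neg_add (.inr (EReal.coe_ne_top _)) (.inr (EReal.coe_ne_bot _)), neg_neg]

theorem infConv_eq_neg_supConv (k : E d → E d → ℝ) (u : E d → EReal) :
    infConv k u = -supConv (fun x y => k y x) (-u) := by
  rw [supConv_eq_neg_infConv, neg_neg, neg_neg]

theorem neg_toExt (u : E d → ℝ) : -toExt u = toExt (-u) := by
  funext q; simp [toExt]

/-- A first-order expansion of the kernel `k` at `(x, y)`, with the quadratic error terms that
the action over a time interval of length `h` has. -/
def HasExpansion (c C h : ℝ) (k : E d → E d → ℝ) (x y p₀ p₁ : E d) : Prop :=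
  ∀ x' y' : E d,
    c / h * ‖(y' - y) - (x' - x)‖ ^ 2 - C * (‖x' - x‖ ^ 2 + ‖y' - y‖ ^ 2) ≤
      k x' y' - k x y - (inner ℝ p₁ (y' - y) - inner ℝ p₀ (x' - x)) ∧
    k x' y' - k x y - (inner ℝ p₁ (y' - y) - inner ℝ p₀ (x' - x)) ≤
      C / h * (‖x' - x‖ ^ 2 + ‖y' - y‖ ^ 2)

theorem HasExpansion.flip {c C h : ℝ} {k : E d → E d → ℝ} {x y p₀ p₁ : E d}
    (H : HasExpansion c C h k x y p₀ p₁) :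
    HasExpansion c C h (fun x y => k y x) y x (-p₁) (-p₀) := by
  intro x' y'
  have := H y' x'
  rw [inner_neg_left, inner_neg_left, norm_sub_rev (y' - x) (x' - y),
    add_comm (‖x' - y‖ ^ 2) (‖y' - x‖ ^ 2)]
  constructor <;> linarith [this.1, this.2]

/-- The properties of the minimal action on which the regularization rests. -/
structure IsTwistKernel (σ c C : ℝ) (A : ℝ → ℝ → E d → E d → ℝ) : Prop where
  triangle : ∀ a b e, a < b → b < e → ∀ x y z, A a e x z ≤ A a b x y + A b e y z
  split : ∀ a b e, a < b → b < e → ∀ x z ε, 0 < ε → ∃ y, A a b x y + A b e y z ≤ A a e x z + ε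
  expansion : ∀ a b, a < b → b - a < σ → ∀ x y, ∃ p₀ p₁,
    HasExpansion c C (b - a) (A a b) x y p₀ p₁
  expansion_left : ∀ a b, a < b → b - a < σ → ∀ x p₀, ∃ y p₁,
    HasExpansion c C (b - a) (A a b) x y p₀ p₁
  expansion_right : ∀ a b, a < b → b - a < σ → ∀ y p₁, ∃ x p₀,
    HasExpansion c C (b - a) (A a b) x y p₀ p₁

/-- The kernel obtained by reversing time. -/
def revKernel (A : ℝ → ℝ → E d → E d → ℝ) : ℝ → ℝ → E d → E d → ℝ :=
  fun a b x y => A (-b) (-a) y x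

/-- Time reversal swaps endpoints and negates momenta, so each result on `R^t` also yields its
counterpart for the dual operator. -/
theorem IsTwistKernel.rev {σ c C : ℝ} {A : ℝ → ℝ → E d → E d → ℝ}
    (hA : IsTwistKernel σ c C A) : IsTwistKernel σ c C (revKernel A) where
  triangle a b e hab hbe x y z := by
    have := hA.triangle (-e) (-b) (-a) (by linarith) (by linarith) z y x
    simp only [revKernel]; linarith
  split a b e hab hbe x z ε hε := by
    obtain ⟨y, hy⟩ := hA.split (-e) (-b) (-a) (by linarith) (by linarith) z x ε hε
    refine ⟨y, ?_⟩
    simp only [revKernel]; linarith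
  expansion a b hab h x y := by
    obtain ⟨p₀, p₁, H⟩ := hA.expansion (-b) (-a) (by linarith) (by linarith) y x
    have := H.flip
    rw [show -a - -b = b - a by ring] at this
    exact ⟨_, _, this⟩
  expansion_left a b hab h x p := by
    obtain ⟨y, p₁, H⟩ := hA.expansion_right (-b) (-a) (by linarith) (by linarith) x (-p)
    have := H.flip
    rw [show -a - -b = b - a by ring, neg_neg] at this
    exact ⟨_, _, this⟩
  expansion_right a b hab h x p := by
    obtain ⟨y, p₁, H⟩ := hA.expansion_left (-b) (-a) (by linarith) (by linarith) x (-p)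
    have := H.flip
    rw [show -a - -b = b - a by ring, neg_neg] at this
    exact ⟨_, _, this⟩

/-- Semigroup property: `triangle` gives one inequality, `split` the other up to `ε`. -/
theorem IsTwistKernel.infConv_comp {σ c C : ℝ} {A : ℝ → ℝ → E d → E d → ℝ}
    (hA : IsTwistKernel σ c C A) {a b e : ℝ} (hab : a < b) (hbe : b < e) (u : E d → EReal) :
    infConv (A a e) u = infConv (A b e) (infConv (A a b) u) := by
  funext q
  apply le_antisymm
  · refine le_iInf fun θ => ?_
    rw [← EReal.sub_le_iff_le_add (.inl (EReal.coe_ne_bot _)) (.inl (EReal.coe_ne_top _))]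
    refine le_iInf fun η => ?_
    rw [EReal.sub_le_iff_le_add (.inl (EReal.coe_ne_bot _)) (.inl (EReal.coe_ne_top _))]
    refine (iInf_le _ η).trans ?_
    rw [add_assoc, ← EReal.coe_add]
    gcongr
    exact hA.triangle a b e hab hbe η θ q
  · refine le_iInf fun η => ?_
    have key : ∀ ε : ℝ, 0 < ε → infConv (A b e) (infConv (A a b) u) q ≤
        u η + ((A a e η q + ε : ℝ) : EReal) := by
      intro ε hε
      obtain ⟨y, hy⟩ := hA.split a b e hab hbe η q ε hε
      refine (iInf_le _ y).trans ?_
      refine (add_le_add_left (iInf_le _ η) _).trans ?_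
      rw [add_assoc, ← EReal.coe_add]
      gcongr
    rw [← EReal.sub_le_iff_le_add (.inl (EReal.coe_ne_bot _)) (.inl (EReal.coe_ne_top _))]
    -- Since `u η` may be infinite, the error is introduced through reals `z > u η`; when `u η` is a
    -- real `r`, it is `ε = z - r`.
    refine EReal.le_of_forall_lt_iff_le.1 fun z hz => ?_
    have hz' : u η ≤ (z : EReal) := hz.le
    rw [EReal.sub_le_iff_le_add (.inl (EReal.coe_ne_bot _)) (.inl (EReal.coe_ne_top _))]
    induction hu : u η using EReal.rec with
    | bot =>
      have := key 1 one_pos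
      rw [hu, EReal.bot_add, le_bot_iff] at this
      rw [this]; exact bot_le
    | top => rw [hu] at hz; simp at hz
    | coe r =>
      rw [hu, EReal.coe_lt_coe_iff] at hz
      have := key (z - r) (by linarith)
      rw [hu, ← EReal.coe_add] at this
      refine this.trans ?_
      rw [← EReal.coe_add, EReal.coe_le_coe_iff]
      linarith

/-- On semi-concave functions, the inf-convolution undoes the sup-convolution in short time. -/
theorem infConv_supConv_toExt {c C h K : ℝ} {k : E d → E d → ℝ} (hK : K + C ≤ c / h)
    (hk : ∀ y p₁, ∃ x p₀, HasExpansion c C h k x y p₀ p₁) {u : E d → ℝ}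
    (hu : ConcaveOn ℝ univ (fun q => u q - K * ‖q‖ ^ 2)) :
    infConv k (supConv k (toExt u)) = toExt u := by
  refine le_antisymm (fun q => ?_) ((gc_supConv_infConv k).le_u_l _)
  obtain ⟨p, hp⟩ := exists_semiconcave_supergradient hu q
  -- The start of the orbit reaching `q` with momentum the supergradient `p`. For this `x` the
  -- function `u η - k x η` is maximal at `η = q`, because `K + C ≤ c/h`.
  obtain ⟨x, p₀, H⟩ := hk q p
  refine (iInf_le _ x).trans ?_
  rw [← EReal.le_sub_iff_add_le (.inl (EReal.coe_ne_bot _)) (.inl (EReal.coe_ne_top _))]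
  refine iSup_le fun η => ?_
  simp only [toExt]
  rw [← EReal.coe_sub, ← EReal.coe_sub, EReal.coe_le_coe_iff]
  have h1 := (H x η).1
  have h2 := hp η
  simp only [sub_self, sub_zero, norm_zero, inner_zero_right] at h1
  have h3 : (K + C) * ‖η - q‖ ^ 2 ≤ c / h * ‖η - q‖ ^ 2 := by gcongr
  nlinarith

/-- On semi-convex functions, the sup-convolution undoes the inf-convolution in short time. -/
theorem supConv_infConv_toExt {c C h K : ℝ} {k : E d → E d → ℝ} (hK : K + C ≤ c / h)
    (hk : ∀ x p₀, ∃ y p₁, HasExpansion c C h k x y p₀ p₁) {u : E d → ℝ}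
    (hu : ConvexOn ℝ univ (fun q => u q + K * ‖q‖ ^ 2)) :
    supConv k (infConv k (toExt u)) = toExt u := by
  have h1 : ConcaveOn ℝ univ (fun q => (-u) q - K * ‖q‖ ^ 2) := by
    refine hu.neg.congr fun q _ => ?_
    simp; ring
  have := infConv_supConv_toExt (k := fun x y => k y x) hK (fun y p₁ => by
    obtain ⟨x, p, H⟩ := hk y (-p₁)
    have := H.flip
    rw [neg_neg] at this
    exact ⟨_, _, this⟩) h1
  rw [supConv_eq_neg_infConv, infConv_eq_neg_supConv k, neg_neg, neg_toExt, this, neg_toExt,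
    neg_neg]

/-- A finite supremum excludes the value `⊤`, and closeness to it excludes `⊥`, so near-maximizers
carry real values. -/
theorem exists_near_supConv {k : E d → E d → ℝ} {g : E d → EReal} {w : E d → ℝ}
    (hw : supConv k g = toExt w) (q : E d) {ε : ℝ} (hε : 0 < ε) :
    ∃ (θ : E d) (r : ℝ), g θ = (r : EReal) ∧ w q - ε < r - k q θ := by
  have h1 : ((w q - ε : ℝ) : EReal) < supConv k g q := by
    rw [hw, toExt, EReal.coe_lt_coe_iff]; linarith
  obtain ⟨θ, hθ⟩ := lt_iSup_iff.1 h1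
  have h2 : g θ - (k q θ : EReal) ≤ (w q : EReal) := by
    rw [← show toExt w q = (w q : EReal) from rfl, ← hw]
    exact le_iSup (fun θ => g θ - (k q θ : EReal)) θ
  refine ⟨θ, ?_⟩
  induction hg : g θ using EReal.rec with
  | bot => rw [hg] at hθ; simp at hθ
  | top => rw [hg] at h2; simp at h2
  | coe r =>
    refine ⟨r, rfl, ?_⟩
    rw [hg, ← EReal.coe_sub, EReal.coe_lt_coe_iff] at hθ
    exact hθ

theorem le_of_supConv_eq {k : E d → E d → ℝ} {g : E d → EReal} {w : E d → ℝ}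
    (hw : supConv k g = toExt w) (q : E d) {θ : E d} {r : ℝ} (hr : (r : EReal) ≤ g θ) :
    r - k q θ ≤ w q := by
  rw [← EReal.coe_le_coe_iff, ← show toExt w q = (w q : EReal) from rfl, ← hw, EReal.coe_sub]
  refine le_trans ?_ (le_iSup (fun θ => g θ - (k q θ : EReal)) θ)
  exact EReal.sub_le_sub hr le_rfl

/-- One finite value of the infimum shows that `f` is never `⊥`, and points where `f = ⊤` impose
nothing. -/
theorem coe_le_infConv {k : E d → E d → ℝ} {f : E d → EReal} {θ₀ : E d} {r₀ : ℝ}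
    (h₀ : infConv k f θ₀ = (r₀ : EReal)) {θ : E d} {r : ℝ}
    (h : ∀ η (s : ℝ), f η = (s : EReal) → r ≤ s + k η θ) : (r : EReal) ≤ infConv k f θ := by
  refine le_iInf fun η => ?_
  induction hf : f η using EReal.rec with
  | bot =>
    exfalso
    have : infConv k f θ₀ ≤ _ := iInf_le _ η
    rw [h₀, hf] at this
    simp at this
  | top => simp
  | coe s =>
    rw [← EReal.coe_add, EReal.coe_le_coe_iff]
    exact h η s hf

/-- Variance identity about a point displaced by `z` from the mean. It turns weighted quadratic
errors into `αβ‖x - y‖²`, the convexity defect of `‖·‖²`. -/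
theorem convex_combo_norm_sq {α β : ℝ} (h : α + β = 1) (x y z : E d) :
    α * ‖x - (α • x + β • y + z)‖ ^ 2 + β * ‖y - (α • x + β • y + z)‖ ^ 2 =
      α * β * ‖x - y‖ ^ 2 + ‖z‖ ^ 2 := by
  obtain rfl : β = 1 - α := by linarith
  have e1 : x - (α • x + (1 - α) • y + z) = (1 - α) • (x - y) - z := by module
  have e2 : y - (α • x + (1 - α) • y + z) = -(α • (x - y) + z) := by module
  rw [e1, e2, norm_neg, norm_sub_sq_real, norm_add_sq_real, norm_smul, norm_smul, inner_smul_left,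
    inner_smul_left, mul_pow, mul_pow, Real.norm_eq_abs, Real.norm_eq_abs, sq_abs, sq_abs]
  simp only [conj_trivial]
  ring

theorem convex_combo_dist_sq {α β : ℝ} (h : α + β = 1) (x y : E d) :
    α * ‖x - (α • x + β • y)‖ ^ 2 + β * ‖y - (α • x + β • y)‖ ^ 2 = α * β * ‖x - y‖ ^ 2 := by
  simpa using convex_combo_norm_sq h x y 0

theorem convex_combo_inner {α β : ℝ} (h : α + β = 1) (p x y : E d) :
    α * inner ℝ p (x - (α • x + β • y)) + β * inner ℝ p (y - (α • x + β • y)) = 0 := by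
  obtain rfl : β = 1 - α := by linarith
  rw [← inner_smul_right, ← inner_smul_right, ← inner_add_right]
  convert inner_zero_right p using 2
  module

/-- Averaging the bounds at `x` and `y`, based at their convex combination, cancels the linear
terms. The slack `ε` lets near-maximizers serve in place of maximizers. -/
theorem convexOn_of_near_subgradient {w : E d → ℝ} {K : ℝ}
    (h : ∀ q ε, 0 < ε → ∃ p, ∀ q', w q - ε + inner ℝ p (q' - q) - K * ‖q' - q‖ ^ 2 ≤ w q') :
    ConvexOn ℝ univ (fun q => w q + K * ‖q‖ ^ 2) := by
  refine ⟨convex_univ, fun x _ y _ α β hα hβ hαβ => ?_⟩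
  simp only [smul_eq_mul]
  refine le_of_forall_pos_le_add fun ε hε => ?_
  obtain ⟨p, hp⟩ := h (α • x + β • y) ε hε
  have h1 := mul_le_mul_of_nonneg_left (hp x) hα
  have h2 := mul_le_mul_of_nonneg_left (hp y) hβ
  have h3 := convex_combo_inner hαβ p x y
  have h4 := convex_combo_dist_sq hαβ x y
  have h5 := convex_combo_norm_sq hαβ x y (-(α • x + β • y))
  simp only [add_neg_cancel, sub_zero, norm_neg] at h5
  set q := α • x + β • y
  obtain rfl : β = 1 - α := by linarith
  have h6 : K * (α * ‖x - q‖ ^ 2 + (1 - α) * ‖y - q‖ ^ 2 + ‖q‖ ^ 2) =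
    K * (α * ‖x‖ ^ 2 + (1 - α) * ‖y‖ ^ 2) := by rw [h5, h4]
  linarith

/-- The regularizing effect of a sup-convolution over a short time that follows an
inf-convolution over a longer one. -/
theorem C11With_of_supConv_infConv {c C h r : ℝ} (hC : 0 < C) (hh : 0 < h) (hr : 0 < r)
    (hcC : 2 * C + 2 * (C / r) ≤ c / h) {k₁ k₂ : E d → E d → ℝ}
    (hk₁ : ∀ x y, ∃ p₀ p₁, HasExpansion c C h k₁ x y p₀ p₁)
    (hk₂ : ∀ x y, ∃ p₀ p₁, HasExpansion c C r k₂ x y p₀ p₁) {f : E d → EReal} {w : E d → ℝ}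
    (hw : supConv k₁ (infConv k₂ f) = toExt w) :
    C11With (6 * (3 * C + 2 * (C / r) + C / h).toNNReal) w := by
  have hCr : 0 < C / r := by positivity
  have hCh : 0 < C / h := by positivity
  have hK : ((3 * C + 2 * (C / r) + C / h).toNNReal : ℝ) = 3 * C + 2 * (C / r) + C / h :=
    Real.coe_toNNReal _ (by positivity)
  refine differentiable_lipschitz_of_semiconvex_semiconcave ?_ ?_
  · rw [hK]
    refine convexOn_of_near_subgradient fun q ε hε => ?_
    -- Semi-convexity: `q' ↦ s - k₁ q' θ` lies below `w`, nearly touches it at `q`, and has a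
    -- quadratic lower expansion with constant `C/h`.
    obtain ⟨θ, s, hs, hlt⟩ := exists_near_supConv hw q hε
    obtain ⟨p₀, p₁, H⟩ := hk₁ q θ
    refine ⟨p₀, fun q' => ?_⟩
    have h1 := le_of_supConv_eq hw q' hs.ge
    have h2 := (H q' θ).2
    simp only [sub_self, norm_zero, inner_zero_right] at h2
    have h3 : 0 ≤ (3 * C + 2 * (C / r)) * ‖q' - q‖ ^ 2 := by positivity
    nlinarith
  · rw [hK]
    refine ⟨convex_univ, fun x _ y _ α β hα hβ hαβ => ?_⟩
    simp only [smul_eq_mul]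
    refine le_of_forall_pos_le_add fun ε hε => ?_
    obtain ⟨θx, sx, hsx, hx⟩ := exists_near_supConv hw x hε
    obtain ⟨θy, sy, hsy, hy⟩ := exists_near_supConv hw y hε
    -- Semi-concavity with constant `C/r` of an infimum of functions `k₂ η`. It bounds from below
    -- the competitor at `q` built from the near-maximizers at `x` and `y`.
    have hg : ((α * sx + β * sy - C / r * (α * β * ‖θx - θy‖ ^ 2) : ℝ) : EReal) ≤
        infConv k₂ f (α • θx + β • θy) := by
      refine coe_le_infConv hsx fun η s hs => ?_
      obtain ⟨p₀, p₁, H⟩ := hk₂ η (α • θx + β • θy)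
      have hle : ∀ {θ : E d} {s' : ℝ}, infConv k₂ f θ = (s' : EReal) → s' ≤ s + k₂ η θ := by
        intro θ s' h'
        rw [← EReal.coe_le_coe_iff, ← h', EReal.coe_add, ← hs]
        exact iInf_le (fun η => f η + (k₂ η θ : EReal)) η
      have h1 := (H η θx).2
      have h2 := (H η θy).2
      simp only [sub_self, norm_zero, inner_zero_right] at h1 h2
      have h3 := convex_combo_inner hαβ p₁ θx θy
      have h4 := convex_combo_dist_sq hαβ θx θy
      rw [← h4]
      have h5 := mul_le_mul_of_nonneg_left (add_le_add h1 (hle hsx)) hα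
      have h6 := mul_le_mul_of_nonneg_left (add_le_add h2 (hle hsy)) hβ
      obtain rfl : β = 1 - α := by linarith
      linarith
    have h1 := le_of_supConv_eq hw (α • x + β • y) hg
    obtain ⟨p₀, p₁, H⟩ := hk₁ (α • x + β • y) (α • θx + β • θy)
    have h2 := mul_le_mul_of_nonneg_left (H x θx).1 hα
    have h3 := mul_le_mul_of_nonneg_left (H y θy).1 hβ
    have h4 := convex_combo_inner hαβ p₁ θx θy
    have h5 := convex_combo_inner hαβ p₀ x y
    have h6 := convex_combo_dist_sq hαβ θx θy
    have h7 := convex_combo_dist_sq hαβ x y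
    have h8 := convex_combo_dist_sq hαβ (θx - x) (θy - y)
    have h9 := convex_combo_norm_sq hαβ x y (-(α • x + β • y))
    simp only [add_neg_cancel, sub_zero, norm_neg] at h9
    rw [show α • (θx - x) + β • (θy - y) = (α • θx + β • θy) - (α • x + β • y) by module,
      show θx - x - ((α • θx + β • θy) - (α • x + β • y)) =
        θx - (α • θx + β • θy) - (x - (α • x + β • y)) by module,
      show θy - y - ((α • θx + β • θy) - (α • x + β • y)) =
        θy - (α • θx + β • θy) - (y - (α • x + β • y)) by module,
      show θx - x - (θy - y) = (θx - θy) - (x - y) by module] at h8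
    have h10 : ‖θx - θy‖ ^ 2 ≤ 2 * ‖(θx - θy) - (x - y)‖ ^ 2 + 2 * ‖x - y‖ ^ 2 := by
      have := parallelogram_law_with_norm ℝ ((θx - θy) - (x - y)) (x - y)
      rw [sub_add_cancel] at this
      nlinarith [sq_nonneg ‖(θx - θy) - (x - y) - (x - y)‖]
    set q := α • x + β • y
    set θ := α • θx + β • θy
    have hx' := mul_le_mul_of_nonneg_left hx.le hα
    have hy' := mul_le_mul_of_nonneg_left hy.le hβ
    have h11 : c / h * (α * β * ‖(θx - θy) - (x - y)‖ ^ 2) -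
        C * (α * β * ‖x - y‖ ^ 2 + α * β * ‖θx - θy‖ ^ 2) ≤
        α * k₁ x θx + β * k₁ y θy - k₁ q θ := by
      rw [← h6, ← h7, ← h8]
      obtain rfl : β = 1 - α := by linarith
      linarith
    have hαβ0 : 0 ≤ α * β := mul_nonneg hα hβ
    -- The place where `h` must be small against `r`. By `h10`, `(C + C/r)‖θx - θy‖²` splits into a
    -- term in the difference of displacements, absorbed by `c/h` through `hcC`, and `(2C + 2C/r)‖x
    -- - y‖²`.
    have h12 : -((3 * C + 2 * (C / r)) * ‖x - y‖ ^ 2) ≤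
        c / h * ‖(θx - θy) - (x - y)‖ ^ 2 - C * (‖x - y‖ ^ 2 + ‖θx - θy‖ ^ 2)
          - C / r * ‖θx - θy‖ ^ 2 := by
      have e1 := mul_le_mul_of_nonneg_right hcC (sq_nonneg ‖(θx - θy) - (x - y)‖)
      have e2 := mul_le_mul_of_nonneg_left h10 (add_pos hC hCr).le
      linarith
    have h13 := mul_le_mul_of_nonneg_left h12 hαβ0
    have h14 : 0 ≤ C / h * (α * β * ‖x - y‖ ^ 2) := by positivity
    have h15 : α * ‖x‖ ^ 2 + β * ‖y‖ ^ 2 = α * β * ‖x - y‖ ^ 2 + ‖q‖ ^ 2 := h9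
    have h16 : (3 * C + 2 * (C / r) + C / h) * (α * ‖x‖ ^ 2 + β * ‖y‖ ^ 2) =
      (3 * C + 2 * (C / r) + C / h) * (α * β * ‖x - y‖ ^ 2 + ‖q‖ ^ 2) := by rw [h15]
    have h17 : α * ε + β * ε = ε := by rw [← add_mul, hαβ, one_mul]
    linarith

end Kernel

/-! ### The regularization theorem for an abstract twist kernel. -/

section Regularization

variable {d : ℕ}

/-- The regularizing operator of a general kernel. -/
noncomputable def regKernel (A : ℝ → ℝ → E d → E d → ℝ) (δ t₀ t : ℝ) (u : E d → EReal) :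
    E d → EReal :=
  supConv (A t₀ (t₀ + δ * t)) (infConv (A (t₀ - t) (t₀ + δ * t)) (supConv (A (t₀ - t) t₀) u))

/-- The dual regularizing operator of a general kernel. -/
noncomputable def regKernelDual (A : ℝ → ℝ → E d → E d → ℝ) (δ t₀ t : ℝ) (u : E d → EReal) :
    E d → EReal :=
  infConv (A (t₀ - δ * t) t₀) (supConv (A (t₀ - δ * t) (t₀ + t)) (infConv (A t₀ (t₀ + t)) u))

theorem revKernel_apply (A : ℝ → ℝ → E d → E d → ℝ) (a b : ℝ) :
    revKernel A a b = fun x y => A (-b) (-a) y x := rfl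

theorem regKernelDual_eq_neg (A : ℝ → ℝ → E d → E d → ℝ) (δ t₀ t : ℝ) (u : E d → EReal) :
    regKernelDual A δ t₀ t u = -regKernel (revKernel A) δ (-t₀) t (-u) := by
  have e1 : -(-t₀ + δ * t) = t₀ - δ * t := by ring
  have e2 : -(-t₀ - t) = t₀ + t := by ring
  simp only [regKernel, regKernelDual, revKernel_apply, e1, e2, neg_neg]
  rw [infConv_eq_neg_supConv (A (t₀ - δ * t) t₀), supConv_eq_neg_infConv (A (t₀ - δ * t) (t₀ + t)),
    infConv_eq_neg_supConv (A t₀ (t₀ + t)), neg_neg, neg_neg]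

theorem C11With.neg {K : NNReal} {u : E d → ℝ} (h : C11With K u) : C11With K (-u) := by
  refine ⟨h.1.neg, ?_⟩
  have : fderiv ℝ (-u) = -fderiv ℝ u := by
    funext x
    rw [fderiv_neg, Pi.neg_apply]
  rw [this]
  exact h.2.neg

theorem C11With.mono {K K' : NNReal} {u : E d → ℝ} (h : C11With K u) (hK : K ≤ K') :
    C11With K' u := ⟨h.1, h.2.weaken hK⟩

theorem SemiConcave.neg {u : E d → ℝ} (h : SemiConcave u) : SemiConvex (-u) := by
  obtain ⟨K, hK⟩ := h
  refine ⟨K, hK.neg.congr fun q _ => ?_⟩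
  simp; ring

theorem SemiConvex.neg {u : E d → ℝ} (h : SemiConvex u) : SemiConcave (-u) := by
  obtain ⟨K, hK⟩ := h
  refine ⟨K, hK.neg.congr fun q _ => ?_⟩
  simp; ring

theorem C11With.expansion {K : NNReal} {u : E d → ℝ} (h : C11With K u) (x y : E d) :
    |u y - u x - fderiv ℝ u x (y - x)| ≤ K * ‖y - x‖ ^ 2 := by
  have := (convex_segment x y).norm_image_sub_le_of_norm_fderiv_le' (f := u) (φ := fderiv ℝ u x)
    (C := K * ‖y - x‖) (fun z _ => h.1 z) (fun z hz => ?_) (left_mem_segment ℝ x y)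
    (right_mem_segment ℝ x y)
  · rw [Real.norm_eq_abs] at this
    nlinarith
  · have h1 := h.2.dist_le_mul z x
    rw [dist_eq_norm, dist_eq_norm] at h1
    refine h1.trans ?_
    gcongr
    obtain ⟨s, hs0, hs, rfl⟩ := (segment_eq_image' ℝ x y ▸ hz : _)
    obtain ⟨hs0, hs⟩ := hs0
    rw [add_sub_cancel_left, norm_smul, Real.norm_of_nonneg hs0]
    nlinarith [norm_nonneg (y - x)]

theorem C11.semiConvex {u : E d → ℝ} (h : C11 u) : SemiConvex u := by
  obtain ⟨K, hK⟩ := h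
  refine ⟨K, convexOn_of_near_subgradient fun q ε hε => ?_⟩
  refine ⟨(InnerProductSpace.toDual ℝ (E d)).symm (fderiv ℝ u q), fun q' => ?_⟩
  rw [InnerProductSpace.toDual_symm_apply]
  linarith [(abs_le.1 (hK.expansion q q')).1]

theorem C11.semiConcave {u : E d → ℝ} (h : C11 u) : SemiConcave u := by
  have h1 : C11 (-u) := ⟨_, h.choose_spec.neg⟩
  simpa using h1.semiConvex.neg

variable {σ c C : ℝ} {A : ℝ → ℝ → E d → E d → ℝ}

/-- Cutting the middle operator at `t₀` exhibits the two compositions of adjoints, one above the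
identity and one below. -/
theorem IsTwistKernel.regKernel_eq (hA : IsTwistKernel σ c C A) {δ t₀ t : ℝ} (hδ : 0 < δ)
    (ht : 0 < t) (u : E d → EReal) :
    regKernel A δ t₀ t u = supConv (A t₀ (t₀ + δ * t)) (infConv (A t₀ (t₀ + δ * t))
      (infConv (A (t₀ - t) t₀) (supConv (A (t₀ - t) t₀) u))) := by
  rw [regKernel, hA.infConv_comp (b := t₀) (by linarith) (by have := mul_pos hδ ht; linarith)]

theorem exists_time (hσ : 0 < σ) (hc : 0 < c) (B : ℝ) :
    ∃ T : ℝ, 0 < T ∧ ∀ h : ℝ, 0 < h → h < T → h < σ ∧ B ≤ c / h := by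
  -- `|B| + 1` keeps the denominator positive, since `B` is an arbitrary real.
  refine ⟨min σ (c / (|B| + 1)), by positivity, fun h h0 hT => ⟨hT.trans_le (min_le_left _ _), ?_⟩⟩
  have h1 := hT.trans_le (min_le_right _ _)
  rw [lt_div_iff₀ (by positivity)] at h1
  rw [le_div_iff₀ h0]
  nlinarith [le_abs_self B]

theorem IsTwistKernel.regKernel_le (hA : IsTwistKernel σ c C A) (hσ : 0 < σ) (hc : 0 < c) {δ : ℝ}
    (hδ : 0 < δ) {u : E d → ℝ} (hu : SemiConcave u) :
    ∃ T : ℝ, 0 < T ∧ ∀ t₀ t : ℝ, 0 < t → t < T → regKernel A δ t₀ t (toExt u) ≤ toExt u := by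
  obtain ⟨K, hK⟩ := hu
  obtain ⟨T, hT, H⟩ := exists_time hσ hc (K + C)
  refine ⟨T, hT, fun t₀ t ht htT => ?_⟩
  obtain ⟨h1, h2⟩ := H t ht htT
  rw [hA.regKernel_eq hδ ht, infConv_supConv_toExt h2 _ hK]
  · exact (gc_supConv_infConv _).l_u_le _
  · intro y p
    simpa using hA.expansion_right (t₀ - t) t₀ (by linarith) (by linarith) y p

theorem IsTwistKernel.le_regKernel (hA : IsTwistKernel σ c C A) (hσ : 0 < σ) (hc : 0 < c) {δ : ℝ}
    (hδ : 0 < δ) (hδ1 : δ < 1) {u : E d → ℝ} (hu : SemiConvex u) :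
    ∃ T : ℝ, 0 < T ∧ ∀ t₀ t : ℝ, 0 < t → t < T → toExt u ≤ regKernel A δ t₀ t (toExt u) := by
  obtain ⟨K, hK⟩ := hu
  obtain ⟨T, hT, H⟩ := exists_time hσ hc (K + C)
  refine ⟨T, hT, fun t₀ t ht htT => ?_⟩
  have hδt : 0 < δ * t := mul_pos hδ ht
  obtain ⟨h1, h2⟩ := H (δ * t) hδt (by nlinarith)
  rw [hA.regKernel_eq hδ ht]
  have h3 := supConv_infConv_toExt (k := A t₀ (t₀ + δ * t)) h2 (fun x p => by
    simpa using hA.expansion_left t₀ (t₀ + δ * t) (by linarith) (by linarith) x p) hK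
  conv_lhs => rw [← h3]
  exact (gc_supConv_infConv _).monotone_l ((gc_supConv_infConv _).monotone_u
    ((gc_supConv_infConv _).le_u_l _))

/-- Only the last portion, of length `ts` with `s = min σ 1 / 2`, of the middle operator is used. As
`ts` and `δt` scale alike, one condition on `δ` serves all `t < 1`. -/
theorem IsTwistKernel.regKernel_C11With (hA : IsTwistKernel σ c C A) (hσ : 0 < σ)
    (hC : 0 < C) {δ : ℝ} (hδ : 0 < δ) (hδ1 : δ < 1) (hδσ : δ < σ)
    (hδc : 2 * C + 2 * (C / (min σ 1 / 2)) ≤ c / δ) {t : ℝ} (ht : 0 < t) (ht1 : t < 1) :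
    ∃ K : NNReal, ∀ (t₀ : ℝ) (u : E d → EReal) (f : E d → ℝ),
      regKernel A δ t₀ t u = toExt f → C11With K f := by
  set s := min σ 1 / 2 with hs
  have hs0 : 0 < s := by positivity
  have hsσ : s < σ := by linarith [min_le_left σ 1]
  have hs1 : s < 1 := by linarith [min_le_right σ 1]
  have hts : 0 < t * s := mul_pos ht hs0
  have htδ : 0 < δ * t := mul_pos hδ ht
  refine ⟨6 * (3 * C + 2 * (C / (t * s)) + C / (δ * t)).toNNReal, fun t₀ u f hf => ?_⟩
  rw [regKernel, hA.infConv_comp (b := t₀ + δ * t - t * s) (by nlinarith) (by linarith)] at hf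
  refine C11With_of_supConv_infConv (c := c) hC htδ hts ?_ (fun x y => ?_) (fun x y => ?_) hf
  · have h1 : c / (δ * t) = (c / δ) / t := by rw [div_div]
    have h2 : C / (t * s) = (C / s) / t := by rw [mul_comm, div_div]
    rw [h1, h2, le_div_iff₀ ht]
    have h3 : C / s / t * t = C / s := by field_simp
    nlinarith
  · simpa using hA.expansion t₀ (t₀ + δ * t) (by linarith) (by nlinarith) x y
  · simpa using hA.expansion (t₀ + δ * t - t * s) (t₀ + δ * t) (by linarith) (by nlinarith) x y

/-- The regularization theorem for a class of kernels with common constants. -/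
theorem exists_regularizing_parameter (hσ : 0 < σ) (hc : 0 < c) (hC : 0 < C) :
    ∃ δ : ℝ, 0 < δ ∧ δ < 1 ∧
      ∀ (d : ℕ) (A : ℝ → ℝ → E d → E d → ℝ), IsTwistKernel σ c C A →
        (∀ t₀ t : ℝ, 0 < t → t < 1 → ∃ K : NNReal, ∀ (u : E d → EReal) (f : E d → ℝ),
          (regKernel A δ t₀ t u = toExt f ∨ regKernelDual A δ t₀ t u = toExt f) → C11With K f) ∧
        (∀ u : E d → ℝ, SemiConcave u → ∃ T : ℝ, 0 < T ∧ ∀ t₀ t : ℝ, 0 < t → t < T →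
          regKernel A δ t₀ t (toExt u) ≤ toExt u ∧ regKernelDual A δ t₀ t (toExt u) ≤ toExt u) ∧
        (∀ u : E d → ℝ, SemiConvex u → ∃ T : ℝ, 0 < T ∧ ∀ t₀ t : ℝ, 0 < t → t < T →
          toExt u ≤ regKernel A δ t₀ t (toExt u) ∧ toExt u ≤ regKernelDual A δ t₀ t (toExt u)) := by
  set B := 2 * C + 2 * (C / (min σ 1 / 2)) with hB
  have hB0 : 0 < B := by positivity
  -- The three bounds give `δ < 1`, `δt < σ` for `t < 1`, and the absorption condition `B ≤ c/δ`.
  refine ⟨min (1 / 2) (min (σ / 2) (c / B)), by positivity,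
    (min_le_left _ _).trans_lt (by norm_num), fun d A hA => ?_⟩
  set δ := min (1 / 2) (min (σ / 2) (c / B)) with hδ
  have hδ0 : 0 < δ := by positivity
  have hδ1 : δ < 1 := (min_le_left _ _).trans_lt (by norm_num)
  have hδσ : δ < σ :=
    ((min_le_right _ _).trans (min_le_left _ _)).trans_lt (by linarith)
  have hδc : B ≤ c / δ := by
    have : δ ≤ c / B := (min_le_right _ _).trans (min_le_right _ _)
    rw [le_div_iff₀ hB0] at this
    rw [le_div_iff₀ hδ0]; linarith
  refine ⟨fun t₀ t ht ht1 => ?_, fun u hu => ?_, fun u hu => ?_⟩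
  · obtain ⟨K, hK⟩ := hA.regKernel_C11With hσ hC hδ0 hδ1 hδσ hδc ht ht1
    obtain ⟨K', hK'⟩ := hA.rev.regKernel_C11With hσ hC hδ0 hδ1 hδσ hδc ht ht1
    refine ⟨max K K', fun u f hf => ?_⟩
    rcases hf with hf | hf
    · exact (hK _ _ _ hf).mono (le_max_left _ _)
    · rw [regKernelDual_eq_neg, neg_eq_iff_eq_neg, neg_toExt] at hf
      simpa using ((hK' _ _ _ hf).neg.mono (le_max_right _ _))
  · obtain ⟨T, hT, H⟩ := hA.regKernel_le hσ hc hδ0 hu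
    obtain ⟨T', hT', H'⟩ := hA.rev.le_regKernel hσ hc hδ0 hδ1 hu.neg
    refine ⟨min T T', lt_min hT hT', fun t₀ t ht htT => ⟨H t₀ t ht (lt_min_iff.1 htT).1, ?_⟩⟩
    rw [regKernelDual_eq_neg, neg_toExt]
    intro q
    have := H' (-t₀) t ht (lt_min_iff.1 htT).2 q
    rw [Pi.neg_apply, EReal.neg_le]
    simpa [toExt] using this
  · obtain ⟨T, hT, H⟩ := hA.le_regKernel hσ hc hδ0 hδ1 hu
    obtain ⟨T', hT', H'⟩ := hA.rev.regKernel_le hσ hc hδ0 hu.neg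
    refine ⟨min T T', lt_min hT hT', fun t₀ t ht htT => ⟨H t₀ t ht (lt_min_iff.1 htT).1, ?_⟩⟩
    rw [regKernelDual_eq_neg, neg_toExt]
    intro q
    have := H' (-t₀) t ht (lt_min_iff.1 htT).2 q
    rw [Pi.neg_apply, EReal.le_neg]
    simpa [toExt] using this

end Regularization

/-! ### Taylor estimates and first-order calculus for an admissible Hamiltonian. -/

/-- Second-order Taylor lower bound on the unit interval. -/
theorem taylor_two_lower {φ φ' φ'' : ℝ → ℝ} {k : ℝ} (h : ∀ τ, HasDerivAt φ (φ' τ) τ)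
    (h' : ∀ τ, HasDerivAt φ' (φ'' τ) τ) (hk : ∀ τ, k ≤ φ'' τ) : k / 2 ≤ φ 1 - φ 0 - φ' 0 := by
  have hmono : Monotone fun τ => φ' τ - k * τ := by
    have hd : ∀ τ, HasDerivAt (fun τ => φ' τ - k * τ) (φ'' τ - k) τ := fun τ => by
      simpa using (h' τ).fun_sub ((hasDerivAt_id' τ).const_mul k)
    refine monotone_of_deriv_nonneg (fun τ => (hd τ).differentiableAt) fun τ => ?_
    rw [(hd τ).deriv]; linarith [hk τ]
  have hd : ∀ τ, HasDerivAt (fun τ => φ τ - φ' 0 * τ - k / 2 * τ ^ 2) (φ' τ - φ' 0 - k * τ) τ := by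
    intro τ
    have := ((h τ).fun_sub ((hasDerivAt_id' τ).const_mul (φ' 0))).fun_sub
      (((hasDerivAt_id' τ).fun_pow 2).const_mul (k / 2))
    refine this.congr_deriv ?_
    push_cast
    ring
  have hmono2 : MonotoneOn (fun τ => φ τ - φ' 0 * τ - k / 2 * τ ^ 2) (Icc 0 1) := by
    refine monotoneOn_of_deriv_nonneg (convex_Icc 0 1)
      (fun τ _ => (hd τ).continuousAt.continuousWithinAt)
      (fun τ _ => (hd τ).differentiableAt.differentiableWithinAt) fun τ hτ => ?_
    rw [(hd τ).deriv]
    rw [interior_Icc] at hτ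
    have := hmono hτ.1.le
    simp only at this
    linarith
  have := hmono2 (left_mem_Icc.2 zero_le_one) (right_mem_Icc.2 zero_le_one) zero_le_one
  simp only at this
  linarith

theorem taylor_two_upper {φ φ' φ'' : ℝ → ℝ} {k : ℝ} (h : ∀ τ, HasDerivAt φ (φ' τ) τ)
    (h' : ∀ τ, HasDerivAt φ' (φ'' τ) τ) (hk : ∀ τ, φ'' τ ≤ k) : φ 1 - φ 0 - φ' 0 ≤ k / 2 := by
  have := taylor_two_lower (k := -k) (fun τ => (h τ).neg) (fun τ => (h' τ).neg)
    (fun τ => neg_le_neg (hk τ))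
  simp only [Pi.neg_apply] at this
  linarith

section Hamiltonian

variable {d : ℕ} {m M : ℝ} {H : ℝ → E d → E d → ℝ}

/-- The partial gradient `∂_p H`. -/
noncomputable def gradP (H : ℝ → E d → E d → ℝ) (t : ℝ) (q p : E d) : E d :=
  gradient (fun y => H t q y) p

/-- The partial gradient `∂_q H`. -/
noncomputable def gradQ (H : ℝ → E d → E d → ℝ) (t : ℝ) (q p : E d) : E d :=
  gradient (fun x => H t x p) q

/-- The inclusion of the momenta into the extended phase space. -/
noncomputable def inP : E d →L[ℝ] ℝ × E d × E d :=
  (ContinuousLinearMap.inr ℝ ℝ (E d × E d)).comp (ContinuousLinearMap.inr ℝ (E d) (E d))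

/-- The inclusion of the positions into the extended phase space. -/
noncomputable def inQ : E d →L[ℝ] ℝ × E d × E d :=
  (ContinuousLinearMap.inr ℝ ℝ (E d × E d)).comp (ContinuousLinearMap.inl ℝ (E d) (E d))

theorem inP_apply (v : E d) : inP v = ((0, 0, v) : ℝ × E d × E d) := rfl

theorem inQ_apply (v : E d) : inQ v = ((0, v, 0) : ℝ × E d × E d) := rfl

theorem enorm2_inP (v : E d) : enorm2 (inP v) = ‖v‖ := by
  simp [enorm2, inP_apply]

theorem enorm2_inQ (v : E d) : enorm2 (inQ v) = ‖v‖ := by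
  simp [enorm2, inQ_apply]

theorem enorm2_le (v w : E d) : enorm2 ((0, v, w) : ℝ × E d × E d) ≤ ‖v‖ + ‖w‖ := by
  rw [enorm2]
  refine Real.sqrt_le_iff.2 ⟨by positivity, ?_⟩
  nlinarith [norm_nonneg v, norm_nonneg w]

theorem hasFDerivAt_mk_p (t : ℝ) (q p : E d) :
    HasFDerivAt (fun y : E d => ((t, q, y) : ℝ × E d × E d)) inP p := by
  simpa [inP_apply] using inP.hasFDerivAt.const_add ((t, q, 0) : ℝ × E d × E d)

theorem hasFDerivAt_mk_q (t : ℝ) (q p : E d) :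
    HasFDerivAt (fun x : E d => ((t, x, p) : ℝ × E d × E d)) inQ q := by
  simpa [inQ_apply] using inQ.hasFDerivAt.const_add ((t, 0, p) : ℝ × E d × E d)

namespace IsAdmissible

theorem hasFDerivAt (hH : IsAdmissible m M H) (x : ℝ × E d × E d) :
    HasFDerivAt (total H) (fderiv ℝ (total H) x) x :=
  (hH.contDiff.differentiable (by norm_num) x).hasFDerivAt

theorem contDiff_fderiv (hH : IsAdmissible m M H) : ContDiff ℝ 1 (fderiv ℝ (total H)) :=
  hH.contDiff.fderiv_right (m := 1) (by norm_num)

theorem hasFDerivAt_fderiv (hH : IsAdmissible m M H) (x : ℝ × E d × E d) :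
    HasFDerivAt (fderiv ℝ (total H)) (fderiv ℝ (fderiv ℝ (total H)) x) x :=
  (hH.contDiff_fderiv.differentiable (by norm_num) x).hasFDerivAt

theorem hasFDerivAt_p (hH : IsAdmissible m M H) (t : ℝ) (q p : E d) :
    HasFDerivAt (H t q) ((fderiv ℝ (total H) (t, q, p)).comp inP) p :=
  HasFDerivAt.comp (g := total H) p (hH.hasFDerivAt (t, q, p)) (hasFDerivAt_mk_p t q p)

theorem hasFDerivAt_q (hH : IsAdmissible m M H) (t : ℝ) (q p : E d) :
    HasFDerivAt (fun x => H t x p) ((fderiv ℝ (total H) (t, q, p)).comp inQ) q :=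
  HasFDerivAt.comp (g := total H) q (hH.hasFDerivAt (t, q, p)) (hasFDerivAt_mk_q t q p)

theorem gradP_eq (hH : IsAdmissible m M H) (t : ℝ) (q p : E d) :
    gradP H t q p =
      (InnerProductSpace.toDual ℝ (E d)).symm ((fderiv ℝ (total H) (t, q, p)).comp inP) := by
  rw [gradP, gradient, (hH.hasFDerivAt_p t q p).fderiv]

theorem gradQ_eq (hH : IsAdmissible m M H) (t : ℝ) (q p : E d) :
    gradQ H t q p =
      (InnerProductSpace.toDual ℝ (E d)).symm ((fderiv ℝ (total H) (t, q, p)).comp inQ) := by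
  rw [gradQ, gradient, (hH.hasFDerivAt_q t q p).fderiv]

theorem inner_gradP (hH : IsAdmissible m M H) (t : ℝ) (q p v : E d) :
    inner ℝ (gradP H t q p) v = fderiv ℝ (total H) (t, q, p) (inP v) := by
  rw [hH.gradP_eq, InnerProductSpace.toDual_symm_apply]; rfl

theorem inner_gradQ (hH : IsAdmissible m M H) (t : ℝ) (q p v : E d) :
    inner ℝ (gradQ H t q p) v = fderiv ℝ (total H) (t, q, p) (inQ v) := by
  rw [hH.gradQ_eq, InnerProductSpace.toDual_symm_apply]; rfl

theorem continuous_gradP (hH : IsAdmissible m M H) :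
    Continuous fun z : ℝ × E d × E d => gradP H z.1 z.2.1 z.2.2 := by
  simp only [hH.gradP_eq]
  exact (LinearIsometryEquiv.continuous _).comp
    (hH.contDiff_fderiv.continuous.clm_comp continuous_const)

theorem continuous_gradQ (hH : IsAdmissible m M H) :
    Continuous fun z : ℝ × E d × E d => gradQ H z.1 z.2.1 z.2.2 := by
  simp only [hH.gradQ_eq]
  exact (LinearIsometryEquiv.continuous _).comp
    (hH.contDiff_fderiv.continuous.clm_comp continuous_const)

theorem hasDerivAt_line (hH : IsAdmissible m M H) (x z : ℝ × E d × E d) (τ : ℝ) :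
    HasDerivAt (fun τ : ℝ => total H (x + τ • z)) (fderiv ℝ (total H) (x + τ • z) z) τ := by
  have h1 : HasDerivAt (fun τ : ℝ => x + τ • z) z τ := by
    simpa using ((hasDerivAt_id τ).smul_const z).const_add x
  exact (hH.hasFDerivAt _).comp_hasDerivAt τ h1

theorem hasDerivAt_fderiv_line (hH : IsAdmissible m M H) (x z w : ℝ × E d × E d) (τ : ℝ) :
    HasDerivAt (fun τ : ℝ => fderiv ℝ (total H) (x + τ • z) w)
      (fderiv ℝ (fderiv ℝ (total H)) (x + τ • z) z w) τ := by
  have h1 : HasDerivAt (fun τ : ℝ => x + τ • z) z τ := by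
    simpa using ((hasDerivAt_id τ).smul_const z).const_add x
  have h2 := (hH.hasFDerivAt_fderiv _).comp_hasDerivAt τ h1
  simpa using h2.clm_apply (hasDerivAt_const τ w)

theorem fderiv_fderiv_p (hH : IsAdmissible m M H) (t : ℝ) (q p v : E d) :
    fderiv ℝ (fderiv ℝ (H t q)) p v v =
      fderiv ℝ (fderiv ℝ (total H)) (t, q, p) (inP v) (inP v) := by
  have h1 : fderiv ℝ (H t q) = fun y => (fderiv ℝ (total H) (t, q, y)).comp inP :=
    funext fun y => (hH.hasFDerivAt_p t q y).fderiv
  have h2 := ((hH.hasFDerivAt_fderiv (t, q, p)).comp p (hasFDerivAt_mk_p t q p)).clm_comp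
    (hasFDerivAt_const inP p)
  rw [h1]
  have h3 := h2.fderiv
  simp only [Function.comp_def] at h3
  rw [h3]
  simp

theorem lower_p (hH : IsAdmissible m M H) (t : ℝ) (q p p' : E d) :
    m / 2 * ‖p' - p‖ ^ 2 ≤ H t q p' - H t q p - inner ℝ (gradP H t q p) (p' - p) := by
  have h := taylor_two_lower (hH.hasDerivAt_line (t, q, p) (inP (p' - p)))
    (hH.hasDerivAt_fderiv_line (t, q, p) (inP (p' - p)) (inP (p' - p)))
    (k := m * ‖p' - p‖ ^ 2) (fun τ => by
      have := hH.convex t q (p + τ • (p' - p)) (p' - p)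
      rw [hH.fderiv_fderiv_p] at this
      simpa [inP_apply] using this)
  rw [hH.inner_gradP]
  simp [total, inP_apply] at h ⊢
  linarith

theorem upper_p (hH : IsAdmissible m M H) (t : ℝ) (q p p' : E d) :
    H t q p' - H t q p - inner ℝ (gradP H t q p) (p' - p) ≤ M / 2 * ‖p' - p‖ ^ 2 := by
  have h := taylor_two_upper (hH.hasDerivAt_line (t, q, p) (inP (p' - p)))
    (hH.hasDerivAt_fderiv_line (t, q, p) (inP (p' - p)) (inP (p' - p)))
    (k := M * ‖p' - p‖ ^ 2) (fun τ => by
      refine (le_abs_self _).trans ((hH.hessian_le _ _ _).trans ?_)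
      rw [enorm2_inP]; nlinarith)
  rw [hH.inner_gradP]
  simp [total, inP_apply] at h ⊢
  linarith

theorem abs_expansion_q (hH : IsAdmissible m M H) (t : ℝ) (q q' p : E d) :
    |H t q' p - H t q p - inner ℝ (gradQ H t q p) (q' - q)| ≤ M / 2 * ‖q' - q‖ ^ 2 := by
  have hb : ∀ τ : ℝ, |fderiv ℝ (fderiv ℝ (total H)) ((t, q, p) + τ • inQ (q' - q)) (inQ (q' - q))
      (inQ (q' - q))| ≤ M * ‖q' - q‖ ^ 2 := fun τ => by
    refine (hH.hessian_le _ _ _).trans ?_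
    rw [enorm2_inQ]; nlinarith
  have h := taylor_two_upper (hH.hasDerivAt_line (t, q, p) (inQ (q' - q)))
    (hH.hasDerivAt_fderiv_line (t, q, p) (inQ (q' - q)) (inQ (q' - q)))
    (fun τ => (abs_le.1 (hb τ)).2)
  have h' := taylor_two_lower (hH.hasDerivAt_line (t, q, p) (inQ (q' - q)))
    (hH.hasDerivAt_fderiv_line (t, q, p) (inQ (q' - q)) (inQ (q' - q)))
    (fun τ => (abs_le.1 (hb τ)).1)
  rw [hH.inner_gradQ, abs_le]
  simp [total, inQ_apply] at h h' ⊢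
  constructor <;> linarith

theorem abs_fderiv_sub_le (hH : IsAdmissible m M H) (x z w : ℝ × E d × E d) :
    |fderiv ℝ (total H) (x + z) w - fderiv ℝ (total H) x w| ≤ M * enorm2 z * enorm2 w := by
  have := norm_image_sub_le_of_norm_deriv_le_segment_01'
    (fun τ _ => (hH.hasDerivAt_fderiv_line x z w τ).hasDerivWithinAt)
    (fun τ _ => hH.hessian_le (x + τ • z) z w)
  simpa using this

theorem norm_gradP_sub_le (hH : IsAdmissible m M H) (hM : 0 < M) (t : ℝ) (q p q' p' : E d) :
    ‖gradP H t q' p' - gradP H t q p‖ ≤ M * (‖q' - q‖ + ‖p' - p‖) := by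
  set g := gradP H t q' p' - gradP H t q p with hg
  -- Testing the Hessian bound against `g` itself gives `‖g‖²` on the left.
  have h1 := hH.abs_fderiv_sub_le (t, q, p) (0, q' - q, p' - p) (inP g)
  have h2 : ((t, q, p) + (0, q' - q, p' - p) : ℝ × E d × E d) = (t, q', p') := by simp
  rw [h2, ← hH.inner_gradP, ← hH.inner_gradP, ← inner_sub_left, ← hg, real_inner_self_eq_norm_sq,
    enorm2_inP] at h1
  have h3 := (le_abs_self _).trans h1
  have h4 := mul_le_mul_of_nonneg_left (enorm2_le (q' - q) (p' - p)) hM.le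
  by_contra! hlt
  have h5 : 0 < ‖g‖ := lt_of_le_of_lt (by positivity) hlt
  nlinarith

theorem norm_gradQ_sub_le (hH : IsAdmissible m M H) (hM : 0 < M) (t : ℝ) (q p q' p' : E d) :
    ‖gradQ H t q' p' - gradQ H t q p‖ ≤ M * (‖q' - q‖ + ‖p' - p‖) := by
  set g := gradQ H t q' p' - gradQ H t q p with hg
  have h1 := hH.abs_fderiv_sub_le (t, q, p) (0, q' - q, p' - p) (inQ g)
  have h2 : ((t, q, p) + (0, q' - q, p' - p) : ℝ × E d × E d) = (t, q', p') := by simp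
  rw [h2, ← hH.inner_gradQ, ← hH.inner_gradQ, ← inner_sub_left, ← hg, real_inner_self_eq_norm_sq,
    enorm2_inQ] at h1
  have h3 := (le_abs_self _).trans h1
  have h4 := mul_le_mul_of_nonneg_left (enorm2_le (q' - q) (p' - p)) hM.le
  by_contra! hlt
  have h5 : 0 < ‖g‖ := lt_of_le_of_lt (by positivity) hlt
  nlinarith

theorem monotone_gradP (hH : IsAdmissible m M H) (t : ℝ) (q p p' : E d) :
    m * ‖p' - p‖ ^ 2 ≤ inner ℝ (gradP H t q p' - gradP H t q p) (p' - p) := by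
  have h1 := hH.lower_p t q p p'
  have h2 := hH.lower_p t q p' p
  rw [norm_sub_rev, ← neg_sub p' p, inner_neg_right] at h2
  rw [inner_sub_left]
  linarith

/-- False in general for `d = 0`, where nothing compares `m` with `M`; later proofs treat that case
apart. -/
theorem const_le [Nontrivial (E d)] (hH : IsAdmissible m M H) : m ≤ M := by
  obtain ⟨v, hv⟩ := exists_ne (0 : E d)
  have h1 := hH.lower_p 0 0 0 v
  have h2 := hH.upper_p 0 0 0 v
  rw [sub_zero] at h1 h2
  have h3 : 0 < ‖v‖ ^ 2 := by positivity
  have := le_of_mul_le_mul_right (h1.trans h2) h3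
  linarith

/-- The Lagrangian, expressed in the momentum variable, is bounded below. -/
theorem lagrangian_lower (hH : IsAdmissible m M H) (hm : 0 < m) (t : ℝ) (q p : E d) :
    -M ≤ inner ℝ p (gradP H t q p) - H t q p := by
  have h1 := hH.lower_p t q p 0
  have h2 := hH.upper t q 0
  rw [zero_sub, inner_neg_right, norm_neg] at h1
  rw [norm_zero] at h2
  rw [real_inner_comm]
  have : 0 ≤ m / 2 * ‖p‖ ^ 2 := by positivity
  linarith

/-- The convexity defect of the Hamiltonian along two phase points. -/
theorem remainder_bounds (hH : IsAdmissible m M H) (t : ℝ) (q p q' p' : E d) :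
    m / 2 * ‖p' - p‖ ^ 2 - M / 2 * ‖q' - q‖ ^ 2 ≤
      H t q p - H t q' p' + inner ℝ (gradP H t q' p') (p' - p) +
        inner ℝ (gradQ H t q p) (q' - q) ∧
    H t q p - H t q' p' + inner ℝ (gradP H t q' p') (p' - p) +
        inner ℝ (gradQ H t q p) (q' - q) ≤
      M / 2 * ‖p' - p‖ ^ 2 + M / 2 * ‖q' - q‖ ^ 2 := by
  -- Going from `(q', p')` to `(q, p)` through `(q', p)` varies one variable at a time, so no mixed
  -- second derivative enters.
  have h1 := hH.lower_p t q' p' p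
  have h2 := hH.upper_p t q' p' p
  have h3 := abs_le.1 (hH.abs_expansion_q t q q' p)
  rw [norm_sub_rev, ← neg_sub p' p, inner_neg_right] at h1 h2
  constructor <;> linarith [h3.1, h3.2]

end IsAdmissible

end Hamiltonian

/-! ### Orbits: action, existence and separation. -/

section Orbits

variable {d : ℕ} {m M : ℝ} {H : ℝ → E d → E d → ℝ} {a b : ℝ} {q p q' p' : ℝ → E d}

theorem IsOrbit.hasDerivWithinAt_q (h : IsOrbit H a b q p) {s : ℝ} (hs : s ∈ Icc a b) :
    HasDerivWithinAt q (gradP H s (q s) (p s)) (Icc a b) s := (h s hs).1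

theorem IsOrbit.hasDerivWithinAt_p (h : IsOrbit H a b q p) {s : ℝ} (hs : s ∈ Icc a b) :
    HasDerivWithinAt p (-gradQ H s (q s) (p s)) (Icc a b) s := (h s hs).2

theorem IsOrbit.mono (h : IsOrbit H a b q p) {a' b' : ℝ} (hsub : Icc a' b' ⊆ Icc a b) :
    IsOrbit H a' b' q p := fun s hs =>
  ⟨(h s (hsub hs)).1.mono hsub, (h s (hsub hs)).2.mono hsub⟩

theorem IsOrbit.continuousOn_q (h : IsOrbit H a b q p) : ContinuousOn q (Icc a b) :=
  fun _ hs => (h.hasDerivWithinAt_q hs).continuousWithinAt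

theorem IsOrbit.continuousOn_p (h : IsOrbit H a b q p) : ContinuousOn p (Icc a b) :=
  fun _ hs => (h.hasDerivWithinAt_p hs).continuousWithinAt

theorem IsOrbit.continuousOn_gradP (h : IsOrbit H a b q p) (hH : IsAdmissible m M H) :
    ContinuousOn (fun s => gradP H s (q s) (p s)) (Icc a b) :=
  hH.continuous_gradP.comp_continuousOn
    (continuousOn_id.prodMk (h.continuousOn_q.prodMk h.continuousOn_p))

theorem IsOrbit.continuousOn_gradQ (h : IsOrbit H a b q p) (hH : IsAdmissible m M H) :
    ContinuousOn (fun s => gradQ H s (q s) (p s)) (Icc a b) :=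
  hH.continuous_gradQ.comp_continuousOn
    (continuousOn_id.prodMk (h.continuousOn_q.prodMk h.continuousOn_p))

theorem IsOrbit.continuousOn_H (h : IsOrbit H a b q p) (hH : IsAdmissible m M H) :
    ContinuousOn (fun s => H s (q s) (p s)) (Icc a b) :=
  hH.contDiff.continuous.comp_continuousOn
    (continuousOn_id.prodMk (h.continuousOn_q.prodMk h.continuousOn_p))

theorem IsOrbit.continuousOn_lagrangian (h : IsOrbit H a b q p) (hH : IsAdmissible m M H) :
    ContinuousOn (fun s => inner ℝ (p s) (gradP H s (q s) (p s)) - H s (q s) (p s)) (Icc a b) :=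
  (h.continuousOn_p.inner (h.continuousOn_gradP hH)).sub (h.continuousOn_H hH)

theorem IsOrbit.action_eq (h : IsOrbit H a b q p) (hab : a < b) :
    action H a b q p =
      ∫ s in a..b, (inner ℝ (p s) (gradP H s (q s) (p s)) - H s (q s) (p s)) := by
  refine intervalIntegral.integral_congr fun s hs => ?_
  rw [uIcc_of_le hab.le] at hs
  beta_reduce
  rw [(h.hasDerivWithinAt_q hs).derivWithin (uniqueDiffOn_Icc hab s hs)]

theorem IsOrbit.action_split (h : IsOrbit H a b q p) (hH : IsAdmissible m M H) {e : ℝ}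
    (hae : a < e) (heb : e < b) :
    action H a b q p = action H a e q p + action H e b q p := by
  have h1 : Icc a e ⊆ Icc a b := Icc_subset_Icc_right heb.le
  have h2 : Icc e b ⊆ Icc a b := Icc_subset_Icc_left hae.le
  rw [h.action_eq (hae.trans heb), (h.mono h1).action_eq hae, (h.mono h2).action_eq heb]
  have hc := h.continuousOn_lagrangian hH
  refine (intervalIntegral.integral_add_adjacent_intervals ?_ ?_).symm
  · exact (hc.mono h1).intervalIntegrable_of_Icc hae.le
  · exact (hc.mono h2).intervalIntegrable_of_Icc heb.le

theorem IsOrbit.action_lower (h : IsOrbit H a b q p) (hH : IsAdmissible m M H) (hm : 0 < m)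
    (hab : a < b) : -M * (b - a) ≤ action H a b q p := by
  rw [h.action_eq hab]
  have h1 : ∫ _ in a..b, (-M : ℝ) = -M * (b - a) := by
    rw [intervalIntegral.integral_const, smul_eq_mul]; ring
  rw [← h1]
  refine intervalIntegral.integral_mono_on hab.le (by simp)
    ((h.continuousOn_lagrangian hH).intervalIntegrable_of_Icc hab.le) fun s _ => ?_
  exact hH.lagrangian_lower hm s (q s) (p s)

theorem integral_bounds_of_continuousOn {f : ℝ → ℝ} (hab : a ≤ b) (hf : ContinuousOn f (Icc a b))
    {k K : ℝ} (hb : ∀ s ∈ Icc a b, k ≤ f s ∧ f s ≤ K) :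
    (b - a) * k ≤ ∫ s in a..b, f s ∧ ∫ s in a..b, f s ≤ (b - a) * K := by
  have h1 : ∀ k : ℝ, ∫ _ in a..b, k = (b - a) * k := fun k => by
    rw [intervalIntegral.integral_const, smul_eq_mul]
  rw [← h1, ← h1]
  have hi := hf.intervalIntegrable_of_Icc (μ := MeasureTheory.volume) hab
  exact ⟨intervalIntegral.integral_mono_on hab (by simp) hi fun s hs => (hb s hs).1,
    intervalIntegral.integral_mono_on hab hi (by simp) fun s hs => (hb s hs).2⟩

/-- The first-order expansion of the action between two orbits, with integral remainder. -/
theorem IsOrbit.action_sub_bounds (h : IsOrbit H a b q p) (h' : IsOrbit H a b q' p')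
    (hH : IsAdmissible m M H) (hab : a < b) {k K : ℝ}
    (hk : ∀ s ∈ Icc a b, k ≤ m / 2 * ‖p' s - p s‖ ^ 2 - M / 2 * ‖q' s - q s‖ ^ 2)
    (hK : ∀ s ∈ Icc a b, M / 2 * ‖p' s - p s‖ ^ 2 + M / 2 * ‖q' s - q s‖ ^ 2 ≤ K) :
    (b - a) * k ≤ action H a b q' p' - action H a b q p -
        (inner ℝ (p b) (q' b - q b) - inner ℝ (p a) (q' a - q a)) ∧
      action H a b q' p' - action H a b q p -
        (inner ℝ (p b) (q' b - q b) - inner ℝ (p a) (q' a - q a)) ≤ (b - a) * K := by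
  -- The boundary terms are the integral of this derivative; subtracting it from the difference of
  -- Lagrangians leaves the expression of `remainder_bounds`.
  have hder : ∀ s ∈ Icc a b, HasDerivWithinAt (fun s => inner ℝ (p s) (q' s - q s))
      (inner ℝ (p s) (gradP H s (q' s) (p' s) - gradP H s (q s) (p s)) +
        inner ℝ (-gradQ H s (q s) (p s)) (q' s - q s)) (Icc a b) s := fun s hs =>
    (h.hasDerivWithinAt_p hs).inner ℝ
      ((h'.hasDerivWithinAt_q hs).sub (h.hasDerivWithinAt_q hs))
  have hcd : ContinuousOn (fun s =>
      (inner ℝ (p s) (gradP H s (q' s) (p' s) - gradP H s (q s) (p s)) : ℝ) +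
        inner ℝ (-gradQ H s (q s) (p s)) (q' s - q s)) (Icc a b) :=
    (h.continuousOn_p.inner ((h'.continuousOn_gradP hH).sub (h.continuousOn_gradP hH))).add
      ((h.continuousOn_gradQ hH).neg.inner (h'.continuousOn_q.sub h.continuousOn_q))
  have hcL := h.continuousOn_lagrangian hH
  have hcL' := h'.continuousOn_lagrangian hH
  have hint := intervalIntegral.integral_eq_sub_of_hasDeriv_right_of_le hab.le
    (fun s hs => (hder s hs).continuousWithinAt)
    (fun s hs => ((hder s (Ioo_subset_Icc_self hs)).hasDerivAt
      (Icc_mem_nhds hs.1 hs.2)).hasDerivWithinAt)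
    (hcd.intervalIntegrable_of_Icc hab.le)
  have hcLL := hcL'.fun_sub hcL
  rw [h.action_eq hab, h'.action_eq hab, ← hint,
    ← intervalIntegral.integral_sub (hcL'.intervalIntegrable_of_Icc hab.le)
      (hcL.intervalIntegrable_of_Icc hab.le),
    ← intervalIntegral.integral_sub
      (hcLL.intervalIntegrable_of_Icc hab.le) (hcd.intervalIntegrable_of_Icc hab.le)]
  refine integral_bounds_of_continuousOn hab.le (hcLL.fun_sub hcd) fun s hs => ?_
  obtain ⟨h1, h2⟩ := hH.remainder_bounds s (q s) (p s) (q' s) (p' s)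
  have e : (inner ℝ (p' s) (gradP H s (q' s) (p' s)) - H s (q' s) (p' s) -
      (inner ℝ (p s) (gradP H s (q s) (p s)) - H s (q s) (p s)) -
      (inner ℝ (p s) (gradP H s (q' s) (p' s) - gradP H s (q s) (p s)) +
        inner ℝ (-gradQ H s (q s) (p s)) (q' s - q s)) : ℝ) =
      H s (q s) (p s) - H s (q' s) (p' s) + inner ℝ (gradP H s (q' s) (p' s)) (p' s - p s) +
        inner ℝ (gradQ H s (q s) (p s)) (q' s - q s) := by
    rw [inner_neg_left, inner_sub_right (p s), inner_sub_right (gradP H s (q' s) (p' s)),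
      real_inner_comm (gradP H s (q' s) (p' s)) (p' s),
      real_inner_comm (gradP H s (q' s) (p' s)) (p s)]
    ring
  rw [e]
  exact ⟨(hk s hs).trans h1, h2.trans (hK s hs)⟩

/-- The Hamiltonian vector field on phase space. -/
noncomputable def hamField (H : ℝ → E d → E d → ℝ) (t : ℝ) (z : E d × E d) : E d × E d :=
  (gradP H t z.1 z.2, -gradQ H t z.1 z.2)

theorem IsAdmissible.norm_hamField_sub_le (hH : IsAdmissible m M H) (hM : 0 < M) (t : ℝ)
    (z z' : E d × E d) :
    ‖hamField H t z' - hamField H t z‖ ≤ M * (‖z'.1 - z.1‖ + ‖z'.2 - z.2‖) := by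
  rw [hamField, hamField, Prod.mk_sub_mk, Prod.norm_mk, neg_sub_neg, norm_sub_rev (gradQ _ _ _ _)]
  exact max_le (hH.norm_gradP_sub_le hM _ _ _ _ _) (hH.norm_gradQ_sub_le hM _ _ _ _ _)

theorem IsAdmissible.lipschitz_hamField (hH : IsAdmissible m M H) (hM : 0 < M) (t : ℝ) :
    LipschitzWith (2 * M).toNNReal (hamField H t) := by
  refine LipschitzWith.of_dist_le_mul fun z z' => ?_
  rw [dist_eq_norm, dist_eq_norm, Real.coe_toNNReal _ (by positivity)]
  refine (hH.norm_hamField_sub_le hM t z' z).trans ?_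
  have h1 : ‖z.1 - z'.1‖ ≤ ‖z - z'‖ := norm_fst_le (z - z')
  have h2 : ‖z.2 - z'.2‖ ≤ ‖z - z'‖ := norm_snd_le (z - z')
  nlinarith

theorem IsAdmissible.continuous_hamField (hH : IsAdmissible m M H) :
    Continuous fun x : ℝ × (E d × E d) => hamField H x.1 x.2 :=
  hH.continuous_gradP.prodMk hH.continuous_gradQ.neg

theorem IsOrbit.hasDerivWithinAt_prod (h : IsOrbit H a b q p) {s : ℝ} (hs : s ∈ Icc a b) :
    HasDerivWithinAt (fun s => (q s, p s)) (hamField H s (q s, p s)) (Icc a b) s :=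
  (h.hasDerivWithinAt_q hs).prodMk (h.hasDerivWithinAt_p hs)

/-- Orbits of admissible Hamiltonians through any phase point exist for short time. -/
theorem IsAdmissible.exists_orbit (hH : IsAdmissible m M H) (hM : 0 < M) (hab : a ≤ b)
    (hsmall : 4 * M * (b - a) ≤ 1) {τ : ℝ} (hτ : τ ∈ Icc a b) (q₀ p₀ : E d) :
    ∃ q p : ℝ → E d, IsOrbit H a b q p ∧ q τ = q₀ ∧ p τ = p₀ := by
  have hcont : ∀ z, Continuous fun s => hamField H s z := fun z =>
    hH.continuous_hamField.comp (continuous_id.prodMk continuous_const)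
  obtain ⟨C₀, hC₀⟩ := isCompact_Icc.exists_bound_of_continuousOn
    (hcont (q₀, p₀)).continuousOn (s := Icc a b)
  have hC0 : 0 ≤ C₀ := (norm_nonneg _).trans (hC₀ τ hτ)
  have hba : 0 ≤ b - a := by linarith
  -- On the ball of radius `R` the speed is at most `C₀ + 2MR`, and `4M(b - a) ≤ 1` gives `(C₀ +
  -- 2MR)(b - a) ≤ R`.
  set R : ℝ := 2 * C₀ * (b - a) with hR
  have hR0 : 0 ≤ R := by positivity
  have hL0 : 0 ≤ C₀ + 2 * M * R := by positivity
  have hPL : IsPicardLindelof (hamField H) (⟨τ, hτ⟩ : Icc a b) (q₀, p₀) R.toNNReal 0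
      (C₀ + 2 * M * R).toNNReal (2 * M).toNNReal := by
    refine ⟨fun t _ => (hH.lipschitz_hamField hM t).lipschitzOnWith,
      fun z _ => (hcont z).continuousOn, fun t ht z hz => ?_, ?_⟩
    · rw [Real.coe_toNNReal _ hR0, mem_closedBall_iff_norm] at hz
      rw [Real.coe_toNNReal _ hL0]
      have h1 := (hH.lipschitz_hamField hM t).dist_le_mul z (q₀, p₀)
      rw [dist_eq_norm, dist_eq_norm, Real.coe_toNNReal _ (by positivity)] at h1
      have h2 := hC₀ t ht
      have h3 := norm_le_norm_add_norm_sub' (hamField H t z) (hamField H t (q₀, p₀))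
      have h4 : 2 * M * ‖z - (q₀, p₀)‖ ≤ 2 * M * R := by gcongr
      linarith
    · rw [Real.coe_toNNReal _ hR0, Real.coe_toNNReal _ hL0]
      have h1 : max (b - τ) (τ - a) ≤ b - a := max_le (by linarith [hτ.1]) (by linarith [hτ.2])
      refine (mul_le_mul_of_nonneg_left h1 hL0).trans ?_
      simp only [NNReal.coe_zero, sub_zero]
      nlinarith
  obtain ⟨α, hα0, hα⟩ := hPL.exists_eq_forall_mem_Icc_hasDerivWithinAt₀
  simp only at hα0
  refine ⟨fun s => (α s).1, fun s => (α s).2, fun s hs => ?_, by simp [hα0], by simp [hα0]⟩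
  exact ⟨(hα s hs).fst, (hα s hs).snd⟩

/-- In short time two orbits separate at most linearly. -/
theorem IsOrbit.norm_sub_sub_le (h : IsOrbit H a b q p) (h' : IsOrbit H a b q' p')
    (hH : IsAdmissible m M H) (hM : 0 < M) (hsmall : 4 * M * (b - a) ≤ 1) {s : ℝ}
    (hs : s ∈ Icc a b) :
    ‖(q' s - q s) - (q' a - q a)‖ ≤ 4 * M * (‖p' a - p a‖ + ‖q' a - q a‖) * (s - a) ∧
    ‖(p' s - p s) - (p' a - p a)‖ ≤ 4 * M * (‖p' a - p a‖ + ‖q' a - q a‖) * (s - a) := by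
  set N := ‖p' a - p a‖ + ‖q' a - q a‖ with hN
  have hN0 : 0 ≤ N := by positivity
  -- Grönwall with rate `2M`: the exponent is at most `1/2`, so the factor is at most 2. Reinserting
  -- this in the equations gives the linear bound.
  have hgr : ∀ s ∈ Icc a b, ‖q' s - q s‖ ≤ 2 * N ∧ ‖p' s - p s‖ ≤ 2 * N := by
    intro s hs
    have hIci : ∀ {q p : ℝ → E d}, IsOrbit H a b q p → ∀ t ∈ Ico a b,
        HasDerivWithinAt (fun s => (q s, p s)) (hamField H t (q t, p t)) (Ici t) t :=
      fun h t ht => (h.hasDerivWithinAt_prod (Ico_subset_Icc_self ht)).mono_of_mem_nhdsWithin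
        (Icc_mem_nhdsGE_of_mem ht)
    have h1 := dist_le_of_trajectories_ODE (δ := N) (hH.lipschitz_hamField hM)
      (h'.continuousOn_q.prodMk h'.continuousOn_p) (hIci h')
      (h.continuousOn_q.prodMk h.continuousOn_p) (hIci h) (by
        rw [dist_eq_norm, Prod.mk_sub_mk, Prod.norm_mk]
        exact max_le (le_add_of_nonneg_left (norm_nonneg _))
          (le_add_of_nonneg_right (norm_nonneg _))) s hs
    rw [dist_eq_norm, Prod.mk_sub_mk, Prod.norm_mk, Real.coe_toNNReal _ (by positivity)] at h1
    have h2 : Real.exp (2 * M * (s - a)) ≤ 2 := by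
      have h3 := Real.add_one_le_exp (-(2 * M * (s - a)))
      have h4 : 2 * M * (s - a) ≤ 1 / 2 := by nlinarith [hs.2]
      have h5 := Real.exp_pos (2 * M * (s - a))
      have h6 : Real.exp (-(2 * M * (s - a))) * Real.exp (2 * M * (s - a)) = 1 := by
        rw [← Real.exp_add]; simp
      nlinarith
    have h3 : N * Real.exp (2 * M * (s - a)) ≤ 2 * N := by nlinarith
    exact ⟨(le_max_left _ _).trans (h1.trans h3), (le_max_right _ _).trans (h1.trans h3)⟩
  have hbound : ∀ t ∈ Icc a b, M * (‖q' t - q t‖ + ‖p' t - p t‖) ≤ 4 * M * N := by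
    intro t ht
    have := hgr t ht
    nlinarith
  constructor
  · refine norm_image_sub_le_of_norm_deriv_le_segment' (f := fun s => q' s - q s)
      (fun t ht => (h'.hasDerivWithinAt_q ht).sub (h.hasDerivWithinAt_q ht)) (fun t ht => ?_) s hs
    exact (hH.norm_gradP_sub_le hM _ _ _ _ _).trans (hbound t (Ico_subset_Icc_self ht))
  · refine norm_image_sub_le_of_norm_deriv_le_segment' (f := fun s => p' s - p s)
      (fun t ht => (h'.hasDerivWithinAt_p ht).sub (h.hasDerivWithinAt_p ht)) (fun t ht => ?_) s hs
    rw [neg_sub_neg, norm_sub_rev]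
    exact (hH.norm_gradQ_sub_le hM _ _ _ _ _).trans (hbound t (Ico_subset_Icc_self ht))

end Orbits

/-! ### Short-time estimates with explicit constants. -/

section Estimates

theorem small_time_bounds {m M h : ℝ} (hm : 0 < m) (hM : 0 < M) (hmM : m ≤ M)
    (hσ : h < sigma m M) : 64 * M ^ 3 * h ≤ m ^ 2 ∧ 4 * M * h ≤ 1 / 16 ∧
    M * (4 * M * h) ≤ m / 16 := by
  rw [sigma, lt_div_iff₀ (by positivity)] at hσ
  have h1 : 64 * M ^ 3 * h ≤ m ^ 2 := by linarith
  refine ⟨h1, ?_, ?_⟩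
  · by_contra! hlt
    have : M ^ 2 * (1 / 16) < M ^ 2 * (4 * M * h) := by gcongr
    nlinarith
  · by_contra! hlt
    have : M * (m / 16) < M * (M * (4 * M * h)) := by gcongr
    nlinarith

/-- Arithmetic for two orbits: `P`, `Q` are the initial distances of momenta and positions, `x`, `y`
the later ones, and `η` will be `4M(b - a)`. The conclusions serve the two bounds on the action and
the twist estimate. -/
theorem energy_bounds {m M η P Q x y : ℝ} (hm : 0 < m) (hM : 0 < M) (hmM : m ≤ M) (hη : 0 ≤ η)
    (hη1 : η ≤ 1 / 16) (hηM : M * η ≤ m / 16) (hP : 0 ≤ P) (hQ : 0 ≤ Q) (hx : 0 ≤ x) (hy : 0 ≤ y)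
    (hxP : |x - P| ≤ η * (P + Q)) (hyQ : |y - Q| ≤ η * (P + Q)) :
    m / 5 * P ^ 2 - 2 * M * Q ^ 2 ≤ m / 2 * x ^ 2 - M / 2 * y ^ 2 ∧
    M / 2 * x ^ 2 + M / 2 * y ^ 2 ≤ 4 * M * (P + Q) ^ 2 ∧
    3 / 10 * m * P ^ 2 - 13 / 10 * M * P * Q - m / 100 * Q ^ 2 ≤
      m * x ^ 2 - M * x * (η * (P + Q)) - M * y * P := by
  obtain ⟨hx1, hx2⟩ := abs_le.1 hxP
  obtain ⟨hy1, hy2⟩ := abs_le.1 hyQ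
  have hηPQ : η * (P + Q) ≤ 1 / 16 * (P + Q) := by gcongr
  have e1 : 225 * P ^ 2 ≤ 512 * x ^ 2 + 2 * Q ^ 2 := by
    have h1 : 15 * P ≤ 16 * x + Q := by linarith
    have h2 : (15 * P) ^ 2 ≤ (16 * x + Q) ^ 2 := by gcongr
    nlinarith [sq_nonneg (16 * x - Q)]
  have e2 : y ^ 2 ≤ 289 / 128 * Q ^ 2 + 2 * (η ^ 2 * P ^ 2) := by
    have h0 : η * Q ≤ 1 / 16 * Q := by gcongr
    have h1 : y ≤ 17 / 16 * Q + η * P := by linarith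
    have h2 : y ^ 2 ≤ (17 / 16 * Q + η * P) ^ 2 := by gcongr
    nlinarith [sq_nonneg (17 / 16 * Q - η * P)]
  have e3 : M * η ^ 2 ≤ m / 256 := by
    have : M * η * η ≤ m / 16 * (1 / 16) := by gcongr
    nlinarith
  have hmx : m * (225 * P ^ 2) ≤ m * (512 * x ^ 2 + 2 * Q ^ 2) := by gcongr
  have hmQ : m * Q ^ 2 ≤ M * Q ^ 2 := by gcongr
  refine ⟨?_, ?_, ?_⟩
  · have h1 : M * y ^ 2 ≤ M * (289 / 128 * Q ^ 2 + 2 * (η ^ 2 * P ^ 2)) := by gcongr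
    have h2 : M * η ^ 2 * P ^ 2 ≤ m / 256 * P ^ 2 := by gcongr
    have h3 : 0 ≤ m * P ^ 2 := by positivity
    have h4 : 0 ≤ M * Q ^ 2 := by positivity
    linarith
  · have h1 : x ^ 2 ≤ (2 * (P + Q)) ^ 2 := by gcongr; linarith
    have h2 : y ^ 2 ≤ (2 * (P + Q)) ^ 2 := by gcongr; linarith
    have h3 : M * x ^ 2 ≤ M * (2 * (P + Q)) ^ 2 := by gcongr
    have h4 : M * y ^ 2 ≤ M * (2 * (P + Q)) ^ 2 := by gcongr
    linarith
  · have h1 : M * x * (η * (P + Q)) ≤ m / 16 * ((17 / 16 * P + 1 / 16 * Q) * (P + Q)) := by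
      have : x ≤ 17 / 16 * P + 1 / 16 * Q := by linarith
      calc M * x * (η * (P + Q)) = (M * η) * (x * (P + Q)) := by ring
        _ ≤ m / 16 * ((17 / 16 * P + 1 / 16 * Q) * (P + Q)) := by gcongr
    have h2 : M * y * P ≤ 17 / 16 * M * P * Q + m / 16 * P ^ 2 := by
      have h0 : η * Q ≤ 1 / 16 * Q := by gcongr
      have h3 : y ≤ 17 / 16 * Q + η * P := by linarith
      have h4 : M * y * P ≤ M * (17 / 16 * Q + η * P) * P := by gcongr
      have h5 : M * η * P ^ 2 ≤ m / 16 * P ^ 2 := by gcongr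
      linarith
    have h6 : m * (P * Q) ≤ M * (P * Q) := by gcongr
    have h7 : 0 ≤ m * P ^ 2 := by positivity
    have h8 : 0 ≤ M * (P * Q) := by positivity
    have h9 : 0 ≤ m * Q ^ 2 := by positivity
    nlinarith

theorem abs_norm_sub_norm_le_of {V : Type*} [NormedAddCommGroup V] {x y : V} {r : ℝ}
    (h : ‖x - y‖ ≤ r) : |‖x‖ - ‖y‖| ≤ r :=
  (abs_norm_sub_norm_le x y).trans h

variable {d : ℕ} {m M : ℝ} {H : ℝ → E d → E d → ℝ} {a b : ℝ} {q p q' p' : ℝ → E d}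

/-- Orbits through any phase point exist for times less than `sigma m M`. -/
theorem IsAdmissible.exists_orbit_of_lt_sigma (hH : IsAdmissible m M H) (hm : 0 < m) (hM : 0 < M)
    (hab : a < b) (hσ : b - a < sigma m M) {τ : ℝ} (hτ : τ ∈ Icc a b) (q₀ p₀ : E d) :
    ∃ q p : ℝ → E d, IsOrbit H a b q p ∧ q τ = q₀ ∧ p τ = p₀ := by
  rcases subsingleton_or_nontrivial (E d) with hs | hs
  · refine ⟨0, 0, fun s _ => ⟨?_, ?_⟩, Subsingleton.elim _ _, Subsingleton.elim _ _⟩ <;>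
    exact (hasDerivWithinAt_const s _ (0 : E d)).congr_deriv (Subsingleton.elim _ _)
  · have := small_time_bounds hm hM hH.const_le hσ
    exact hH.exists_orbit hM hab.le (by linarith) hτ q₀ p₀

/-- The basic estimates on the distance between two orbits in short time. Here `P` and `Q` are the
distances of the initial momenta and positions. -/
theorem IsOrbit.short_time_estimates (h : IsOrbit H a b q p) (h' : IsOrbit H a b q' p')
    (hH : IsAdmissible m M H) (hm : 0 < m) (hM : 0 < M) (hab : a < b) (hσ : b - a < sigma m M)
    {P Q : ℝ} (hP : P = ‖p' a - p a‖) (hQ : Q = ‖q' a - q a‖) :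
    (∀ s ∈ Icc a b, ‖(q' s - q s) - (q' a - q a)‖ ≤ 4 * M * (P + Q) * (s - a) ∧
      ‖(p' s - p s) - (p' a - p a)‖ ≤ 4 * M * (P + Q) * (s - a)) ∧
    (b - a) * (m / 5 * P ^ 2 - 2 * M * Q ^ 2) ≤ action H a b q' p' - action H a b q p -
        (inner ℝ (p b) (q' b - q b) - inner ℝ (p a) (q' a - q a)) ∧
    action H a b q' p' - action H a b q p -
        (inner ℝ (p b) (q' b - q b) - inner ℝ (p a) (q' a - q a)) ≤
      (b - a) * (4 * M * (P + Q) ^ 2) ∧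
    (b - a) * (3 / 10 * m * P ^ 2 - 13 / 10 * M * P * Q - m / 100 * Q ^ 2) ≤
      inner ℝ ((q' b - q b) - (q' a - q a)) (p' a - p a) := by
  rcases subsingleton_or_nontrivial (E d) with hs | hs
  · obtain rfl : q' = q := Subsingleton.elim _ _
    obtain rfl : p' = p := Subsingleton.elim _ _
    simp [hP, hQ]
  have hP0 : 0 ≤ P := by rw [hP]; positivity
  have hQ0 : 0 ≤ Q := by rw [hQ]; positivity
  have hmM := hH.const_le
  obtain ⟨-, hs1, hs2⟩ := small_time_bounds hm hM hmM hσ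
  have hdist : ∀ s ∈ Icc a b, ‖(q' s - q s) - (q' a - q a)‖ ≤ 4 * M * (P + Q) * (s - a) ∧
      ‖(p' s - p s) - (p' a - p a)‖ ≤ 4 * M * (P + Q) * (s - a) := fun s hs => by
    rw [hP, hQ]
    exact h.norm_sub_sub_le h' hH hM (by linarith) hs
  have hdist' : ∀ s ∈ Icc a b, ‖(q' s - q s) - (q' a - q a)‖ ≤ 4 * M * (b - a) * (P + Q) ∧
      ‖(p' s - p s) - (p' a - p a)‖ ≤ 4 * M * (b - a) * (P + Q) := fun s hs => by
    have h1 : 4 * M * (P + Q) * (s - a) ≤ 4 * M * (P + Q) * (b - a) := by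
      gcongr; exact hs.2
    have h2 := hdist s hs
    constructor <;> linarith [h2.1, h2.2]
  have hen := fun s hs => energy_bounds hm hM hmM (by have := sub_pos.2 hab; positivity) hs1 hs2
    hP0 hQ0 (norm_nonneg (p' s - p s)) (norm_nonneg (q' s - q s))
    (by have := abs_norm_sub_norm_le_of (hdist' s hs).2; rwa [← hP] at this)
    (by have := abs_norm_sub_norm_le_of (hdist' s hs).1; rwa [← hQ] at this)
  have hact := h.action_sub_bounds h' hH hab (fun s hs => (hen s hs).1)
    (fun s hs => (hen s hs).2.1)
  refine ⟨hdist, hact.1, hact.2, ?_⟩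
  set v := p' a - p a with hv
  -- Strong monotonicity of the final position in the initial momentum, by differentiating against
  -- the fixed vector `v`. The velocity difference splits into a change of momentum, which is
  -- monotone, and a change of position, which is Lipschitz.
  have hder : ∀ s ∈ Icc a b, HasDerivWithinAt (fun s => (inner ℝ (q' s - q s) v : ℝ))
      (inner ℝ (gradP H s (q' s) (p' s) - gradP H s (q s) (p s)) v) (Icc a b) s := fun s hs => by
    simpa using ((h'.hasDerivWithinAt_q hs).fun_sub (h.hasDerivWithinAt_q hs)).inner ℝ
      (hasDerivWithinAt_const s (Icc a b) v)
  have hderAt : ∀ s ∈ Ioo a b, HasDerivAt (fun s => (inner ℝ (q' s - q s) v : ℝ))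
      (inner ℝ (gradP H s (q' s) (p' s) - gradP H s (q s) (p s)) v) s := fun s hs =>
    (hder s (Ioo_subset_Icc_self hs)).hasDerivAt (Icc_mem_nhds hs.1 hs.2)
  have key := (convex_Icc a b).mul_sub_le_image_sub_of_le_deriv
    (f := fun s => (inner ℝ (q' s - q s) v : ℝ))
    (C := 3 / 10 * m * P ^ 2 - 13 / 10 * M * P * Q - m / 100 * Q ^ 2)
    (fun s hs => (hder s hs).continuousWithinAt)
    (fun s hs => by
      rw [interior_Icc] at hs
      exact (hderAt s hs).differentiableAt.differentiableWithinAt)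
    (fun s hs => by
      rw [interior_Icc] at hs
      rw [(hderAt s hs).deriv]
      have hs' := Ioo_subset_Icc_self hs
      refine (hen s hs').2.2.trans ?_
      have h1 := hH.monotone_gradP s (q' s) (p s) (p' s)
      have h2 := hH.norm_gradP_sub_le hM s (q' s) (p s) (q' s) (p' s)
      have h3 := hH.norm_gradP_sub_le hM s (q s) (p s) (q' s) (p s)
      simp only [sub_self, norm_zero, zero_add, add_zero] at h2 h3
      rw [← sub_add_sub_cancel (gradP H s (q' s) (p' s)) (gradP H s (q' s) (p s)), inner_add_left]
      have h4 := (abs_le.1 ((abs_real_inner_le_norm _ v).trans (mul_le_mul_of_nonneg_right h3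
        (norm_nonneg v)))).1
      have h5 := (abs_le.1 ((abs_real_inner_le_norm _ _).trans (mul_le_mul h2 (hdist' s hs').2
        (norm_nonneg _) (by positivity)))).2
      rw [inner_sub_right] at h5
      rw [← hP] at h4
      linarith)
    a (left_mem_Icc.2 hab.le) b (right_mem_Icc.2 hab.le) hab.le
  rw [inner_sub_left]
  linarith

theorem IsOrbit.momentum_bound (h : IsOrbit H a b q p) (h' : IsOrbit H a b q' p')
    (hH : IsAdmissible m M H) (hm : 0 < m) (hM : 0 < M) (hab : a < b) (hσ : b - a < sigma m M) :
    m * (b - a) * ‖p' a - p a‖ ≤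
      4 * ‖(q' b - q b) - (q' a - q a)‖ + 5 * M * (b - a) * ‖q' a - q a‖ := by
  rcases subsingleton_or_nontrivial (E d) with hs | hs
  · have hz : ∀ v : E d, ‖v‖ = 0 := fun v => by rw [Subsingleton.elim v 0, norm_zero]
    simp [hz]
  have hmM := hH.const_le
  obtain ⟨-, -, -, h1⟩ := h.short_time_estimates h' hH hm hM hab hσ rfl rfl
  have h2 := h1.trans (real_inner_le_norm _ _)
  set P := ‖p' a - p a‖
  set Q := ‖q' a - q a‖
  set D := ‖(q' b - q b) - (q' a - q a)‖
  have hP : 0 ≤ P := norm_nonneg _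
  have hQ : 0 ≤ Q := norm_nonneg _
  have hD : 0 ≤ D := norm_nonneg _
  have hh : 0 < b - a := sub_pos.2 hab
  set t := b - a
  have hMQ : 0 ≤ M * t * Q := by positivity
  -- If `P ≤ Q` the `Q` term alone suffices; otherwise `P > 0`, and the twist estimate can be
  -- divided by `P`.
  rcases le_or_gt P Q with hPQ | hPQ
  · have : m * t * P ≤ M * t * Q := by gcongr
    linarith
  · have h3 : m / 100 * Q ^ 2 ≤ M / 100 * (P * Q) := by
      rw [sq]; gcongr
    have h4 : t * (3 / 10 * m * P - 131 / 100 * M * Q) * P ≤ D * P := by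
      refine le_trans ?_ h2
      have : 0 ≤ t * (M / 100 * (P * Q) - m / 100 * Q ^ 2) := by
        apply mul_nonneg hh.le; linarith
      nlinarith
    have h5 := le_of_mul_le_mul_right h4 (hQ.trans_lt hPQ)
    nlinarith

theorem IsOrbit.eqOn_of_endpoints (h : IsOrbit H a b q p) (h' : IsOrbit H a b q' p')
    (hH : IsAdmissible m M H) (hm : 0 < m) (hM : 0 < M) (hab : a < b) (hσ : b - a < sigma m M)
    (ha : q' a = q a) (hb : q' b = q b) : ∀ s ∈ Icc a b, q' s = q s ∧ p' s = p s := by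
  intro s hs
  have h1 := h.momentum_bound h' hH hm hM hab hσ
  have hh : 0 < b - a := sub_pos.2 hab
  simp only [ha, hb, sub_self, norm_zero, mul_zero, add_zero] at h1
  have h2 : ‖p' a - p a‖ = 0 := by
    refine le_antisymm ?_ (norm_nonneg _)
    exact nonpos_of_mul_nonpos_right h1 (by positivity)
  have h3 := (h.short_time_estimates h' hH hm hM hab hσ rfl rfl).1 s hs
  rw [norm_eq_zero] at h2
  simp only [h2, ha, sub_self, norm_zero, add_zero, mul_zero, zero_mul, sub_zero] at h3
  exact ⟨sub_eq_zero.1 (norm_le_zero_iff.1 h3.1), sub_eq_zero.1 (norm_le_zero_iff.1 h3.2)⟩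

/-- The constant in the lower bound for the generating function. -/
noncomputable def twistLower (m M : ℝ) : ℝ := m / (160 * M ^ 2)

/-- The constant in the upper bound for the generating function. -/
noncomputable def twistUpper (m M : ℝ) : ℝ :=
  256 * M / m ^ 2 + 5 * sigma m M + 3 * M * sigma m M

/-- Since `D ≤ 4M(P + Q)t`, the term `P²` dominates `D²/t²` up to `Q²`. The constant of `twistLower`
is fixed by `32M² · m/(160M²) = m/5`. -/
theorem IsOrbit.action_lower_bound (h : IsOrbit H a b q p) (h' : IsOrbit H a b q' p')
    (hH : IsAdmissible m M H) (hm : 0 < m) (hM : 0 < M) (hab : a < b) (hσ : b - a < sigma m M) :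
    twistLower m M / (b - a) * ‖(q' b - q b) - (q' a - q a)‖ ^ 2
        - 3 * M * (b - a) * ‖q' a - q a‖ ^ 2 ≤
      action H a b q' p' - action H a b q p -
        (inner ℝ (p b) (q' b - q b) - inner ℝ (p a) (q' a - q a)) := by
  rcases subsingleton_or_nontrivial (E d) with hs | hs
  · obtain rfl : q' = q := Subsingleton.elim _ _
    obtain rfl : p' = p := Subsingleton.elim _ _
    simp
  have hmM := hH.const_le
  obtain ⟨h1, h2, -, -⟩ := h.short_time_estimates h' hH hm hM hab hσ rfl rfl
  refine le_trans ?_ h2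
  have h3 := (h1 b (right_mem_Icc.2 hab.le)).1
  set P := ‖p' a - p a‖
  set Q := ‖q' a - q a‖
  set D := ‖(q' b - q b) - (q' a - q a)‖
  have hP : 0 ≤ P := norm_nonneg _
  have hQ : 0 ≤ Q := norm_nonneg _
  have hD : 0 ≤ D := norm_nonneg _
  have hh : 0 < b - a := sub_pos.2 hab
  set t := b - a
  have h4 : D ^ 2 ≤ (4 * M * (P + Q) * t) ^ 2 := by gcongr
  have h5 : D ^ 2 ≤ 32 * M ^ 2 * t ^ 2 * (P ^ 2 + Q ^ 2) := by
    have : 0 ≤ M ^ 2 * t ^ 2 * (P - Q) ^ 2 := by positivity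
    nlinarith
  have h6 : twistLower m M / t * D ^ 2 ≤ t * (m / 5 * (P ^ 2 + Q ^ 2)) := by
    have : twistLower m M / t * D ^ 2 ≤
        twistLower m M / t * (32 * M ^ 2 * t ^ 2 * (P ^ 2 + Q ^ 2)) := by
      have : 0 < twistLower m M := by rw [twistLower]; positivity
      gcongr
    refine this.trans (le_of_eq ?_)
    rw [twistLower]
    field_simp
    ring
  have h7 : t * (m * Q ^ 2) ≤ t * (M * Q ^ 2) := by gcongr
  have h8 : 0 ≤ t * (M * Q ^ 2) := by positivity
  linarith

/-- The hypothesis `hle` holds when the two orbits share an endpoint position, which is the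
situation of the triangle inequality. -/
theorem IsOrbit.action_lower_bound_nonneg (h : IsOrbit H a b q p) (h' : IsOrbit H a b q' p')
    (hH : IsAdmissible m M H) (hm : 0 < m) (hM : 0 < M) (hab : a < b) (hσ : b - a < sigma m M)
    (hle : ‖q' a - q a‖ ≤ ‖(q' b - q b) - (q' a - q a)‖) :
    inner ℝ (p b) (q' b - q b) - inner ℝ (p a) (q' a - q a) ≤
      action H a b q' p' - action H a b q p := by
  rcases subsingleton_or_nontrivial (E d) with hs | hs
  · obtain rfl : q' = q := Subsingleton.elim _ _
    obtain rfl : p' = p := Subsingleton.elim _ _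
    simp
  have hmM := hH.const_le
  obtain ⟨hs1, hs2, -⟩ := small_time_bounds hm hM hmM hσ
  have h1 := h.action_lower_bound h' hH hm hM hab hσ
  set Q := ‖q' a - q a‖
  set D := ‖(q' b - q b) - (q' a - q a)‖
  have hQ : 0 ≤ Q := norm_nonneg _
  have hh : 0 < b - a := sub_pos.2 hab
  set t := b - a
  have h2 : 3 * M * t ≤ twistLower m M / t := by
    rw [le_div_iff₀ hh, twistLower, le_div_iff₀ (by positivity)]
    have e1 : 64 * M ^ 3 * t * t ≤ m ^ 2 * t := by gcongr
    have e2 : m * t ≤ M * t := by gcongr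
    nlinarith
  have h3 : 0 ≤ twistLower m M / t := le_trans (by positivity) h2
  have h4 : 3 * M * t * Q ^ 2 ≤ twistLower m M / t * D ^ 2 := by gcongr
  linarith

/-- `momentum_bound` replaces `P` by `D/t` and `Q`. The first two terms of `twistUpper` come from
here; the last, `3Mσ`, serves the lower expansion. -/
theorem IsOrbit.action_upper_bound (h : IsOrbit H a b q p) (h' : IsOrbit H a b q' p')
    (hH : IsAdmissible m M H) (hm : 0 < m) (hM : 0 < M) (hab : a < b) (hσ : b - a < sigma m M) :
    action H a b q' p' - action H a b q p -
        (inner ℝ (p b) (q' b - q b) - inner ℝ (p a) (q' a - q a)) ≤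
      twistUpper m M / (b - a) * (‖q' a - q a‖ ^ 2 + ‖q' b - q b‖ ^ 2) := by
  have hσ0 : 0 < sigma m M := (sub_pos.2 hab).trans hσ
  rcases subsingleton_or_nontrivial (E d) with hs | hs
  · obtain rfl : q' = q := Subsingleton.elim _ _
    obtain rfl : p' = p := Subsingleton.elim _ _
    simp
  have hmM := hH.const_le
  obtain ⟨hs1, -, -⟩ := small_time_bounds hm hM hmM hσ
  obtain ⟨-, -, h1, -⟩ := h.short_time_estimates h' hH hm hM hab hσ rfl rfl
  refine h1.trans ?_
  have h2 := h.momentum_bound h' hH hm hM hab hσ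
  have h3 : ‖(q' b - q b) - (q' a - q a)‖ ^ 2 ≤ 2 * ‖q' a - q a‖ ^ 2 + 2 * ‖q' b - q b‖ ^ 2 := by
    have : ‖(q' b - q b) - (q' a - q a)‖ ^ 2 ≤ (‖q' b - q b‖ + ‖q' a - q a‖) ^ 2 := by
      gcongr; exact norm_sub_le _ _
    nlinarith [sq_nonneg (‖q' b - q b‖ - ‖q' a - q a‖)]
  set P := ‖p' a - p a‖
  set Q := ‖q' a - q a‖
  set Y := ‖q' b - q b‖
  set D := ‖(q' b - q b) - (q' a - q a)‖
  have hP : 0 ≤ P := norm_nonneg _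
  have hQ : 0 ≤ Q := norm_nonneg _
  have hD : 0 ≤ D := norm_nonneg _
  have hh : 0 < b - a := sub_pos.2 hab
  set t := b - a
  have h4 : m * t * (P + Q) ≤ 4 * D + 6 * M * t * Q := by
    have : m * t * Q ≤ M * t * Q := by gcongr
    linarith
  have h5 : (m * t * (P + Q)) ^ 2 ≤ 32 * D ^ 2 + 72 * M ^ 2 * t ^ 2 * Q ^ 2 := by
    have : (m * t * (P + Q)) ^ 2 ≤ (4 * D + 6 * M * t * Q) ^ 2 := by gcongr
    nlinarith [sq_nonneg (4 * D - 6 * M * t * Q)]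
  have h6 : t ^ 2 * (4 * M * (P + Q) ^ 2) ≤ twistUpper m M * (Q ^ 2 + Y ^ 2) := by
    have e1 : t ^ 2 * (4 * M * (P + Q) ^ 2) =
        4 * M / m ^ 2 * (m * t * (P + Q)) ^ 2 := by field_simp
    have e2 : 4 * M / m ^ 2 * (m * t * (P + Q)) ^ 2 ≤
        4 * M / m ^ 2 * (32 * (2 * Q ^ 2 + 2 * Y ^ 2) + 72 * M ^ 2 * t ^ 2 * Q ^ 2) := by
      have : 0 ≤ 4 * M / m ^ 2 := by positivity
      gcongr
      linarith
    have e3 : 4 * M / m ^ 2 * (72 * M ^ 2 * t ^ 2 * Q ^ 2) ≤ 5 * sigma m M * Q ^ 2 := by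
      have f1 : 4 * M / m ^ 2 * (72 * M ^ 2 * t ^ 2 * Q ^ 2) =
        (9 / 2) * ((64 * M ^ 3 * t) / m ^ 2) * t * Q ^ 2 := by field_simp; ring
      have f2 : (64 * M ^ 3 * t) / m ^ 2 ≤ 1 := by rw [div_le_one (by positivity)]; exact hs1
      rw [f1]
      have f3 : (9 / 2) * ((64 * M ^ 3 * t) / m ^ 2) * t ≤ 9 / 2 * 1 * t := by gcongr
      have f4 : (9 / 2) * ((64 * M ^ 3 * t) / m ^ 2) * t ≤ 5 * sigma m M := by linarith
      gcongr
    have e4 : 4 * M / m ^ 2 * (32 * (2 * Q ^ 2 + 2 * Y ^ 2)) =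
        256 * M / m ^ 2 * (Q ^ 2 + Y ^ 2) := by ring
    have e5 : 0 ≤ sigma m M * Y ^ 2 := by positivity
    have e6 : 0 ≤ M * sigma m M * (Q ^ 2 + Y ^ 2) := by positivity
    rw [e1, twistUpper]
    linarith
  rw [div_mul_eq_mul_div, le_div_iff₀ hh]
  linarith

end Estimates

/-! ### The twist property and the generating function. -/

section GeneratingFunction

/-- A Lipschitz strongly monotone map of a Hilbert space is surjective. -/
theorem surjective_of_strongly_monotone {V : Type*} [NormedAddCommGroup V] [InnerProductSpace ℝ V]
    [CompleteSpace V] {F : V → V} {α L : ℝ} (hα : 0 < α) (hL : 0 < L)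
    (hmono : ∀ x y, α * ‖x - y‖ ^ 2 ≤ inner ℝ (F x - F y) (x - y))
    (hlip : ∀ x y, ‖F x - F y‖ ≤ L * ‖x - y‖) : Function.Surjective F := by
  intro y
  set N := L + α with hN
  have hN0 : 0 < N := by positivity
  -- This step minimizes the squared contraction factor `1 - 2ατ + N²τ²`, with value `1 - (α/N)²`.
  -- Taking `N = L + α` ensures `α/N < 1`.
  set τ := α / N ^ 2 with hτ
  have hτ0 : 0 < τ := by positivity
  set κ := Real.sqrt (1 - (α / N) ^ 2) with hκ
  have hαN : α / N < 1 := by rw [div_lt_one hN0]; linarith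
  have hκ0 : 0 ≤ 1 - (α / N) ^ 2 := by
    have : (α / N) ^ 2 ≤ 1 ^ 2 := by gcongr
    linarith
  have hκ1 : κ < 1 := by
    rw [hκ, Real.sqrt_lt' one_pos]
    have : 0 < (α / N) ^ 2 := by positivity
    linarith
  have hcontr : ContractingWith κ.toNNReal fun x => x - τ • (F x - y) := by
    refine ⟨by rw [Real.toNNReal_lt_one]; exact hκ1, LipschitzWith.of_dist_le_mul fun x z => ?_⟩
    rw [dist_eq_norm, dist_eq_norm, Real.coe_toNNReal _ (Real.sqrt_nonneg _)]
    have e : x - τ • (F x - y) - (z - τ • (F z - y)) = (x - z) - τ • (F x - F z) := by module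
    have h0 : 0 ≤ κ * ‖x - z‖ := by positivity
    rw [e]
    refine abs_le_of_sq_le_sq' ?_ h0 |>.2
    rw [norm_sub_sq_real, inner_smul_right, norm_smul, Real.norm_of_nonneg hτ0.le, mul_pow,
      mul_pow, Real.sq_sqrt hκ0, real_inner_comm]
    have h1 := hmono x z
    have h2 : ‖F x - F z‖ ^ 2 ≤ (N * ‖x - z‖) ^ 2 := by
      have := hlip x z
      have h3 : L * ‖x - z‖ ≤ N * ‖x - z‖ := by gcongr; linarith
      gcongr
      exact this.trans h3
    have h3 : τ * (α * ‖x - z‖ ^ 2) ≤ τ * inner ℝ (F x - F z) (x - z) := by gcongr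
    have h4 : τ ^ 2 * ‖F x - F z‖ ^ 2 ≤ τ ^ 2 * (N * ‖x - z‖) ^ 2 := by gcongr
    have h5 : τ ^ 2 * (N * ‖x - z‖) ^ 2 = (α / N) ^ 2 * ‖x - z‖ ^ 2 := by
      rw [hτ]; field_simp
    have h6 : τ * (α * ‖x - z‖ ^ 2) = (α / N) ^ 2 * ‖x - z‖ ^ 2 := by
      rw [hτ]; field_simp
    linarith
  have hfix := hcontr.fixedPoint_isFixedPt
  refine ⟨hcontr.fixedPoint, ?_⟩
  have h1 : τ • (F hcontr.fixedPoint - y) = 0 := by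
    have := hfix.eq
    simpa using this
  exact sub_eq_zero.1 ((smul_eq_zero.1 h1).resolve_left hτ0.ne')

variable {d : ℕ} {m M : ℝ} {H : ℝ → E d → E d → ℝ} {a b : ℝ} {q p q' p' : ℝ → E d}

/-- The twist property: in short time, there is an orbit between any two positions. -/
theorem IsAdmissible.exists_orbit_endpoints (hH : IsAdmissible m M H) (hm : 0 < m) (hM : 0 < M)
    (hab : a < b) (hσ : b - a < sigma m M) (q₀ q₁ : E d) :
    ∃ q p : ℝ → E d, IsOrbit H a b q p ∧ q a = q₀ ∧ q b = q₁ := by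
  choose q p horb hq hp using fun p₀ : E d =>
    hH.exists_orbit_of_lt_sigma hm hM hab hσ (left_mem_Icc.2 hab.le) q₀ p₀
  have hh : 0 < b - a := sub_pos.2 hab
  have hest := fun x y => (horb y).short_time_estimates (horb x) hH hm hM hab hσ rfl rfl
  -- Shooting: with the initial position fixed, `Q = 0` and the twist estimate is strong
  -- monotonicity in `p₀`.
  have hsurj : Function.Surjective fun p₀ => q p₀ b := by
    refine surjective_of_strongly_monotone (α := (b - a) * (3 / 10 * m)) (L := 4 * M * (b - a))
      (by positivity) (by positivity) (fun x y => ?_) (fun x y => ?_)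
    · have := (hest x y).2.2.2
      simp only [hq, hp, sub_self, norm_zero, sub_zero] at this
      linarith
    · have := ((hest x y).1 b (right_mem_Icc.2 hab.le)).1
      simp only [hq, hp, sub_self, norm_zero, sub_zero] at this
      linarith
  obtain ⟨p₀, hp₀⟩ := hsurj q₁
  exact ⟨q p₀, p p₀, horb p₀, hq p₀, hp₀⟩

/-- Uniqueness of the orbit with given endpoints makes the choice in `genFun` immaterial. -/
theorem IsOrbit.genFun_eq (h : IsOrbit H a b q p) (hH : IsAdmissible m M H) (hm : 0 < m)
    (hM : 0 < M) (hab : a < b) (hσ : b - a < sigma m M) :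
    genFun H a b (q a) (q b) = action H a b q p := by
  have hex : ∃ x : (ℝ → E d) × (ℝ → E d), IsOrbit H a b x.1 x.2 ∧ x.1 a = q a ∧ x.1 b = q b :=
    ⟨(q, p), h, rfl, rfl⟩
  rw [genFun, dif_pos hex]
  obtain ⟨h', ha, hb⟩ := hex.choose_spec
  have heq := h.eqOn_of_endpoints h' hH hm hM hab hσ ha hb
  rw [h'.action_eq hab, h.action_eq hab]
  refine intervalIntegral.integral_congr fun s hs => ?_
  rw [uIcc_of_le hab.le] at hs
  rw [(heq s hs).1, (heq s hs).2]

theorem sigma_pos (hm : 0 < m) (hM : 0 < M) : 0 < sigma m M := by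
  rw [sigma]; positivity

theorem twistLower_pos (hm : 0 < m) (hM : 0 < M) : 0 < twistLower m M := by
  rw [twistLower]; positivity

theorem twistUpper_pos (hm : 0 < m) (hM : 0 < M) : 0 < twistUpper m M := by
  have := sigma_pos hm hM
  rw [twistUpper]; positivity

theorem IsOrbit.hasExpansion (h : IsOrbit H a b q p) (hH : IsAdmissible m M H) (hm : 0 < m)
    (hM : 0 < M) (hab : a < b) (hσ : b - a < sigma m M) :
    HasExpansion (twistLower m M) (twistUpper m M) (b - a) (genFun H a b) (q a) (q b) (p a)
      (p b) := by
  intro x' y'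
  obtain ⟨q', p', h', rfl, rfl⟩ := hH.exists_orbit_endpoints hm hM hab hσ x' y'
  rw [h.genFun_eq hH hm hM hab hσ, h'.genFun_eq hH hm hM hab hσ]
  refine ⟨le_trans ?_ (h.action_lower_bound h' hH hm hM hab hσ),
    h.action_upper_bound h' hH hm hM hab hσ⟩
  have hC : 3 * M * (b - a) ≤ twistUpper m M := by
    have h1 : 3 * M * (b - a) ≤ 3 * M * sigma m M := by gcongr
    have h2 := sigma_pos hm hM
    have h3 : 0 ≤ 256 * M / m ^ 2 := by positivity
    rw [twistUpper]; linarith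
  have h1 : 3 * M * (b - a) * ‖q' a - q a‖ ^ 2 ≤ twistUpper m M * ‖q' a - q a‖ ^ 2 := by gcongr
  have h2 : 0 ≤ twistUpper m M * ‖q' b - q b‖ ^ 2 := by
    have := twistUpper_pos hm hM
    positivity
  linarith

theorem IsAdmissible.neg_mul_le_genFun (hH : IsAdmissible m M H) (hm : 0 < m) (hM : 0 < M)
    (hab : a < b) (hσ : b - a < sigma m M) (x y : E d) : -M * (b - a) ≤ genFun H a b x y := by
  obtain ⟨q, p, h, rfl, rfl⟩ := hH.exists_orbit_endpoints hm hM hab hσ x y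
  rw [h.genFun_eq hH hm hM hab hσ]
  exact h.action_lower hH hm hab

theorem IsAdmissible.genFun_split (hH : IsAdmissible m M H) (hm : 0 < m) (hM : 0 < M) {e : ℝ}
    (hae : a < e) (heb : e < b) (hσ : b - a < sigma m M) (x z : E d) :
    ∃ y, genFun H a b x z = genFun H a e x y + genFun H e b y z := by
  obtain ⟨q, p, h, rfl, rfl⟩ := hH.exists_orbit_endpoints hm hM (hae.trans heb) hσ x z
  refine ⟨q e, ?_⟩
  rw [h.genFun_eq hH hm hM (hae.trans heb) hσ, h.action_split hH hae heb,
    (h.mono (Icc_subset_Icc_right heb.le)).genFun_eq hH hm hM hae (by linarith),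
    (h.mono (Icc_subset_Icc_left hae.le)).genFun_eq hH hm hM heb (by linarith)]

/-- Compare the broken path with the two halves of the orbit from `x` to `z`. The boundary terms at
time `e` cancel, and each half shares an endpoint with its competitor, so both remainders are
nonnegative. -/
theorem IsAdmissible.genFun_triangle (hH : IsAdmissible m M H) (hm : 0 < m) (hM : 0 < M) {e : ℝ}
    (hae : a < e) (heb : e < b) (hσ : b - a < sigma m M) (x y z : E d) :
    genFun H a b x z ≤ genFun H a e x y + genFun H e b y z := by
  obtain ⟨q, p, h, rfl, rfl⟩ := hH.exists_orbit_endpoints hm hM (hae.trans heb) hσ x z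
  have h₁ := h.mono (Icc_subset_Icc_right heb.le : Icc a e ⊆ _)
  have h₂ := h.mono (Icc_subset_Icc_left hae.le : Icc e b ⊆ _)
  obtain ⟨q₁, p₁, g₁, ha₁, he₁⟩ := hH.exists_orbit_endpoints hm hM hae (by linarith) (q a) y
  obtain ⟨q₂, p₂, g₂, he₂, hb₂⟩ := hH.exists_orbit_endpoints hm hM heb (by linarith) y (q b)
  have k₁ := h₁.action_lower_bound_nonneg g₁ hH hm hM hae (by linarith) (by simp [ha₁])
  have k₂ := h₂.action_lower_bound_nonneg g₂ hH hm hM heb (by linarith)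
    (by rw [hb₂, sub_self, zero_sub, norm_neg])
  rw [← g₁.genFun_eq hH hm hM hae (by linarith)] at k₁
  rw [← g₂.genFun_eq hH hm hM heb (by linarith)] at k₂
  rw [h.genFun_eq hH hm hM (hae.trans heb) hσ, h.action_split hH hae heb]
  rw [ha₁, he₁] at k₁
  rw [he₂, hb₂] at k₂
  simp only [sub_self, inner_zero_right] at k₁ k₂
  linarith

end GeneratingFunction

/-! ### Chains over arbitrary subdivisions. -/

section Chains

variable {d : ℕ}

/-- `Chain S σ a b x y s`: the points `x` at time `a` and `y` at time `b` are joined by finitely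
many pieces, each of duration less than `σ`, with total cost `s`. -/
inductive Chain (S : ℝ → ℝ → E d → E d → ℝ) (σ a : ℝ) (x : E d) : ℝ → E d → ℝ → Prop
  | single {b : ℝ} (hab : a < b) (hσ : b - a < σ) (y : E d) : Chain S σ a x b y (S a b x y)
  | snoc {b e : ℝ} {y : E d} {s : ℝ} (h : Chain S σ a x b y s) (hbe : b < e) (hσ : e - b < σ)
      (z : E d) : Chain S σ a x e z (s + S b e y z)

variable {S : ℝ → ℝ → E d → E d → ℝ} {σ a b e : ℝ} {x y z : E d} {s r : ℝ}

theorem Chain.lt (h : Chain S σ a x b y s) : a < b := by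
  induction h with
  | single hab _ _ => exact hab
  | snoc _ hbe _ _ ih => exact ih.trans hbe

theorem Chain.append (h : Chain S σ a x b y s) (h' : Chain S σ b y e z r) :
    Chain S σ a x e z (s + r) := by
  induction h' with
  | single hbe hσ z => exact h.snoc hbe hσ z
  | snoc _ hbe hσ z ih =>
    rw [← add_assoc]
    exact ih.snoc hbe hσ z

theorem Chain.lower {k : ℝ} (hlow : ∀ a b, a < b → b - a < σ → ∀ x y, k * (b - a) ≤ S a b x y)
    (h : Chain S σ a x b y s) : k * (b - a) ≤ s := by
  induction h with
  | single hab hσ y => exact hlow _ _ hab hσ _ _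
  | @snoc b e y _ _ hbe hσ z ih =>
    have := hlow b e hbe hσ y z
    linarith

theorem Chain.split
    (hsplit : ∀ a e b, a < e → e < b → b - a < σ → ∀ x z, ∃ y, S a b x z = S a e x y + S e b y z)
    (h : Chain S σ a x b y s) (hae : a < e) (heb : e < b) :
    ∃ z s₁ s₂, Chain S σ a x e z s₁ ∧ Chain S σ e z b y s₂ ∧ s = s₁ + s₂ := by
  induction h with
  | single hab hσ y =>
    obtain ⟨z, hz⟩ := hsplit _ e _ hae heb hσ x y
    exact ⟨z, _, _, .single hae (by linarith) z, .single heb (by linarith) y, hz⟩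
  | @snoc b c y s h hbc hσ w ih =>
    rcases lt_trichotomy e b with hlt | rfl | hgt
    · obtain ⟨z, s₁, s₂, h₁, h₂, rfl⟩ := ih hlt
      exact ⟨z, s₁, _, h₁, h₂.snoc hbc hσ w, add_assoc _ _ _⟩
    · exact ⟨y, s, _, h, .single hbc hσ w, rfl⟩
    · obtain ⟨z, hz⟩ := hsplit _ e _ hgt heb hσ y w
      exact ⟨z, _, _, h.snoc hgt (by linarith) z, .single heb (by linarith) w,
        by rw [hz, add_assoc]⟩

theorem Chain.le_of_short
    (htri : ∀ a e b, a < e → e < b → b - a < σ → ∀ x y z, S a b x z ≤ S a e x y + S e b y z)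
    (h : Chain S σ a x b y s) (hσ : b - a < σ) : S a b x y ≤ s := by
  induction h with
  | single _ _ _ => exact le_rfl
  | @snoc b c y s h hbc hσ' w ih =>
    have h1 := ih (by linarith)
    have h2 := htri a b c h.lt hbc hσ x y w
    linarith

/-- Cut the chain at the uniform grid, then merge what lies between consecutive grid times by the
triangle inequality. Arbitrary subdivisions are needed because concatenating two uniform ones is not
uniform in general. -/
theorem Chain.exists_uniform
    (hsplit : ∀ a e b, a < e → e < b → b - a < σ → ∀ x z, ∃ y, S a b x z = S a e x y + S e b y z)
    (htri : ∀ a e b, a < e → e < b → b - a < σ → ∀ x y z, S a b x z ≤ S a e x y + S e b y z)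
    {h : ℝ} (hh : 0 < h) (hhσ : h < σ) (n : ℕ) :
    ∀ {y : E d} {s : ℝ}, Chain S σ a x (a + (n + 1) * h) y s →
      ∃ θ : ℕ → E d, θ 0 = x ∧ θ (n + 1) = y ∧
        ∑ i ∈ Finset.range (n + 1), S (a + i * h) (a + (i + 1) * h) (θ i) (θ (i + 1)) ≤ s := by
  induction n with
  | zero =>
    intro y s hc
    refine ⟨fun i => if i = 0 then x else y, by simp, by simp, ?_⟩
    have := hc.le_of_short htri (by simpa using hhσ)
    simpa using this
  | succ n ih =>
    intro y s hc
    have hn : (0 : ℝ) ≤ n := n.cast_nonneg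
    obtain ⟨z, s₁, s₂, h₁, h₂, rfl⟩ := hc.split hsplit (e := a + (n + 1) * h)
      (by nlinarith) (by push_cast; nlinarith)
    obtain ⟨θ, h0, hn1, hs⟩ := ih h₁
    refine ⟨fun i => if i ≤ n + 1 then θ i else y, by simpa using h0, by simp, ?_⟩
    rw [Finset.sum_range_succ]
    refine add_le_add (le_trans (le_of_eq ?_) hs) ?_
    · refine Finset.sum_congr rfl fun i hi => ?_
      rw [Finset.mem_range] at hi
      beta_reduce
      rw [if_pos (by omega), if_pos (by omega)]
    · have := h₂.le_of_short htri (by push_cast; linarith)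
      push_cast at this ⊢
      simpa [hn1] using this

theorem Chain.of_uniform {h : ℝ} (hh : 0 < h) (hhσ : h < σ) (θ : ℕ → E d) (n : ℕ) :
    Chain S σ a (θ 0) (a + (n + 1) * h) (θ (n + 1))
      (∑ i ∈ Finset.range (n + 1), S (a + i * h) (a + (i + 1) * h) (θ i) (θ (i + 1))) := by
  induction n with
  | zero =>
    have := Chain.single (S := S) (σ := σ) (a := a) (b := a + (0 + 1) * h) (x := θ 0)
      (by linarith) (by linarith) (θ 1)
    simpa using this
  | succ n ih =>
    rw [Finset.sum_range_succ]
    have := ih.snoc (e := a + ((n + 1 : ℕ) + 1) * h) (by push_cast; linarith)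
      (by push_cast; linarith) (θ (n + 1 + 1))
    push_cast at this ⊢
    exact this

end Chains

/-! ### The minimal action as a twist kernel, and the theorem. -/

section MinimalAction

variable {d : ℕ} {m M : ℝ} {H : ℝ → E d → E d → ℝ} {a b : ℝ} {x y : E d} {s : ℝ}

theorem pieces_spec (hm : 0 < m) (hM : 0 < M) (hab : a < b) :
    ∃ n : ℕ, pieces m M a b = n + 1 ∧ ∃ h : ℝ, 0 < h ∧ h < sigma m M ∧
      (b - a) / pieces m M a b = h ∧ a + (n + 1) * h = b := by
  have hσ := sigma_pos hm hM
  have hn : (0 : ℝ) < (pieces m M a b : ℝ) := by rw [pieces]; positivity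
  refine ⟨_, rfl, (b - a) / pieces m M a b, div_pos (sub_pos.2 hab) hn, ?_, rfl, ?_⟩
  · rw [div_lt_iff₀ hn, ← div_lt_iff₀' hσ, pieces]
    push_cast
    exact Nat.lt_floor_add_one _
  · have : (⌊(b - a) / sigma m M⌋₊ + 1 : ℝ) = pieces m M a b := by rw [pieces]; push_cast; rfl
    rw [this, mul_div_cancel₀ _ hn.ne']; ring

theorem IsAdmissible.chain_lower (hH : IsAdmissible m M H) (hm : 0 < m) (hM : 0 < M)
    (h : Chain (genFun H) (sigma m M) a x b y s) : -M * (b - a) ≤ s :=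
  h.lower fun _ _ hab hσ x y => hH.neg_mul_le_genFun hm hM hab hσ x y

theorem IsAdmissible.minAction_le (hH : IsAdmissible m M H) (hm : 0 < m) (hM : 0 < M)
    (h : Chain (genFun H) (sigma m M) a x b y s) : minAction m M H a b x y ≤ s := by
  obtain ⟨n, hn, r, hr0, hrσ, hr, hb⟩ := pieces_spec hm hM h.lt
  rw [minAction, hr, hn]
  rw [← hb] at h
  obtain ⟨θ, h0, h1, hs⟩ := h.exists_uniform
    (fun a e b hae heb hσ x z => hH.genFun_split hm hM hae heb hσ x z)
    (fun a e b hae heb hσ x y z => hH.genFun_triangle hm hM hae heb hσ x y z) hr0 hrσ n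
  -- The infimum is taken in `ℝ`, so a lower bound is required; it comes from the Lagrangian being
  -- at least `-M`.
  refine le_trans (csInf_le ?_ ⟨θ, h0, h1, rfl⟩) hs
  refine ⟨-M * (a + (n + 1) * r - a), ?_⟩
  rintro _ ⟨θ, rfl, rfl, rfl⟩
  exact hH.chain_lower hm hM (Chain.of_uniform hr0 hrσ θ n)

theorem exists_chain (hm : 0 < m) (hM : 0 < M) (hab : a < b)
    (H : ℝ → E d → E d → ℝ) (x y : E d) {ε : ℝ} (hε : 0 < ε) :
    ∃ s, Chain (genFun H) (sigma m M) a x b y s ∧ s < minAction m M H a b x y + ε := by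
  obtain ⟨n, hn, r, hr0, hrσ, hr, hb⟩ := pieces_spec hm hM hab
  rw [minAction, hr, hn]
  obtain ⟨s, ⟨θ, rfl, rfl, rfl⟩, hs⟩ := exists_lt_of_csInf_lt (s := {s : ℝ | ∃ θ : ℕ → E d,
      θ 0 = x ∧ θ (n + 1) = y ∧ s = ∑ i ∈ Finset.range (n + 1),
        genFun H (a + i * r) (a + (i + 1) * r) (θ i) (θ (i + 1))})
    ⟨_, fun i => if i = 0 then x else y, by simp, by simp, rfl⟩ (lt_add_of_pos_right _ hε)
  refine ⟨_, ?_, hs⟩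
  have := Chain.of_uniform (S := genFun H) (a := a) hr0 hrσ θ n
  rwa [hb] at this

theorem IsAdmissible.minAction_eq_genFun (hH : IsAdmissible m M H) (hm : 0 < m) (hM : 0 < M)
    (hab : a < b) (hσ : b - a < sigma m M) : minAction m M H a b = genFun H a b := by
  funext x y
  refine le_antisymm (hH.minAction_le hm hM (.single hab hσ y)) ?_
  refine le_of_forall_pos_le_add fun ε hε => ?_
  obtain ⟨s, hs, hlt⟩ := exists_chain hm hM hab H x y hε
  exact (hs.le_of_short
    (fun a e b hae heb hσ x y z => hH.genFun_triangle hm hM hae heb hσ x y z) hσ).trans hlt.le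

/-- The minimal action of an admissible Hamiltonian is a twist kernel, with constants that depend
only on `m` and `M`. -/
theorem IsAdmissible.isTwistKernel (hH : IsAdmissible m M H) (hm : 0 < m) (hM : 0 < M) :
    IsTwistKernel (sigma m M) (twistLower m M) (twistUpper m M) (minAction m M H) where
  triangle a b e hab hbe x y z := by
    refine le_of_forall_pos_le_add fun ε hε => ?_
    obtain ⟨s₁, h₁, hlt₁⟩ := exists_chain hm hM hab H x y (half_pos hε)
    obtain ⟨s₂, h₂, hlt₂⟩ := exists_chain hm hM hbe H y z (half_pos hε)
    have := hH.minAction_le hm hM (h₁.append h₂)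
    linarith
  split a b e hab hbe x z ε hε := by
    obtain ⟨s, h, hlt⟩ := exists_chain hm hM (hab.trans hbe) H x z hε
    obtain ⟨y, s₁, s₂, h₁, h₂, rfl⟩ := h.split
      (fun a e b hae heb hσ x z => hH.genFun_split hm hM hae heb hσ x z) hab hbe
    exact ⟨y, (add_le_add (hH.minAction_le hm hM h₁) (hH.minAction_le hm hM h₂)).trans hlt.le⟩
  expansion a b hab hσ x y := by
    obtain ⟨q, p, h, rfl, rfl⟩ := hH.exists_orbit_endpoints hm hM hab hσ x y
    rw [hH.minAction_eq_genFun hm hM hab hσ]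
    exact ⟨_, _, h.hasExpansion hH hm hM hab hσ⟩
  expansion_left a b hab hσ x p₀ := by
    obtain ⟨q, p, h, rfl, rfl⟩ :=
      hH.exists_orbit_of_lt_sigma hm hM hab hσ (left_mem_Icc.2 hab.le) x p₀
    rw [hH.minAction_eq_genFun hm hM hab hσ]
    exact ⟨_, _, h.hasExpansion hH hm hM hab hσ⟩
  expansion_right a b hab hσ y p₁ := by
    obtain ⟨q, p, h, rfl, rfl⟩ :=
      hH.exists_orbit_of_lt_sigma hm hM hab hσ (right_mem_Icc.2 hab.le) y p₁
    rw [hH.minAction_eq_genFun hm hM hab hσ]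
    exact ⟨_, _, h.hasExpansion hH hm hM hab hσ⟩

end MinimalAction

end WeakKAM

theorem mainTheorem10 (m M : ℝ) (hm : 0 < m) (hM : 0 < M) :
    ∃ δ : ℝ, 0 < δ ∧ δ < 1 ∧
      ∀ (d : ℕ) (H : ℝ → WeakKAM.E d → WeakKAM.E d → ℝ), WeakKAM.IsAdmissible m M H →
        (∀ t₀ t : ℝ, 0 < t → t < 1 → ∃ K : NNReal,
          ∀ (u : WeakKAM.E d → EReal) (f : WeakKAM.E d → ℝ),
            (WeakKAM.regOp m M H δ t₀ t u = WeakKAM.toExt f ∨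
              WeakKAM.regOpDual m M H δ t₀ t u = WeakKAM.toExt f) →
            WeakKAM.C11With K f) ∧
        (∀ u : WeakKAM.E d → ℝ, WeakKAM.SemiConcave u →
          ∃ T : ℝ, 0 < T ∧ ∀ t₀ t : ℝ, 0 < t → t < T →
            WeakKAM.regOp m M H δ t₀ t (WeakKAM.toExt u) ≤ WeakKAM.toExt u ∧
            WeakKAM.regOpDual m M H δ t₀ t (WeakKAM.toExt u) ≤ WeakKAM.toExt u) ∧
        (∀ u : WeakKAM.E d → ℝ, WeakKAM.SemiConvex u →
          ∃ T : ℝ, 0 < T ∧ ∀ t₀ t : ℝ, 0 < t → t < T →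
            WeakKAM.toExt u ≤ WeakKAM.regOp m M H δ t₀ t (WeakKAM.toExt u) ∧
            WeakKAM.toExt u ≤ WeakKAM.regOpDual m M H δ t₀ t (WeakKAM.toExt u)) ∧
        (∀ u : WeakKAM.E d → ℝ, WeakKAM.C11 u →
          ∃ T : ℝ, 0 < T ∧ ∀ t₀ t : ℝ, 0 < t → t < T →
            WeakKAM.regOp m M H δ t₀ t (WeakKAM.toExt u) = WeakKAM.toExt u ∧
            WeakKAM.regOpDual m M H δ t₀ t (WeakKAM.toExt u) = WeakKAM.toExt u) := by
  obtain ⟨δ, hδ0, hδ1, hδ⟩ := WeakKAM.exists_regularizing_parameter (WeakKAM.sigma_pos hm hM)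
    (WeakKAM.twistLower_pos hm hM) (WeakKAM.twistUpper_pos hm hM)
  refine ⟨δ, hδ0, hδ1, fun d H hH => ?_⟩
  -- `regOp` and `regOpDual` unfold definitionally to the kernel operators of `minAction`.
  obtain ⟨h1, h2, h3⟩ := hδ d _ (hH.isTwistKernel hm hM)
  refine ⟨h1, h2, h3, fun u hu => ?_⟩
  obtain ⟨T₁, hT₁, g₁⟩ := h2 u hu.semiConcave
  obtain ⟨T₂, hT₂, g₂⟩ := h3 u hu.semiConvex
  refine ⟨min T₁ T₂, lt_min hT₁ hT₂, fun t₀ t ht htT => ?_⟩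
  obtain ⟨e₁, e₂⟩ := g₁ t₀ t ht (lt_min_iff.1 htT).1
  obtain ⟨f₁, f₂⟩ := g₂ t₀ t ht (lt_min_iff.1 htT).2
  exact ⟨le_antisymm e₁ f₁, le_antisymm e₂ f₂⟩
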